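/- Let $\boldsymbol k$ be a field, $\mathcal A$ a commutative unital $\boldsymbol k$-algebra and $\Omega$ a commutative semigroup, written additively; $[\,\cdot\,]$ denotes sums taken in $\Omega$. **Words.** Let $\mathcal H^\Omega$ be the $\boldsymbol k$-vector space with basis the words $w=\omega_1\cdots\omega_n$ ($n\ge 0$) on $\Omega$, with $\mathbf 1$ the empty word and $\|w\|=[\omega_1+\dots+\omega_n]\in\Omega$ for $w\ne\mathbf 1$. The quasi-shuffle product $*$ is the bilinear product with unit $\mathbf 1$ such that $av*bw=a(v*bw)+b(av*w)+[a+b](v*w)$ for letters $a,b$ and words $v,w$. Put $\Delta(w)=\sum_{w=w'w''}w'\otimes w''$ and $\Gamma(w)=\sum_{w=w^1\cdots w^s}\|w^1\|\cdots\|w^s\|\otimes(w^1*\cdots*w^s)$, the sum being over all decompositions of $w$ into nonempty words $w^i$ (so $\Gamma(\mathbf 1)=\mathbf 1\otimes\mathbf 1$). For $b\in\Omega$ let $L^b(w)=wb$. A mould is a linear map $M:\mathcal H^\Omega\to\mathcal A$. **Forests.** An $\Omega$-decorated rooted forest is a finite oriented graph without oriented cycles in which every vertex has at most one incoming edge, together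 with a map from its vertex set $\mathcal V(F)$ to $\Omega$. Write $u<v$ if a nontrivial oriented path leads from $u$ to $v$. Let $\mathcal H^\Omega_<$ be the $\boldsymbol k$-vector space with basis the isomorphism classes of such forests; it is a commutative algebra for the disjoint union. $B_+^b(F)$ is the tree obtained by grafting all the trees of $F$ on a new root decorated by $b$. The admissible-cut coproduct is $$\Delta(F)=\sum_{V_1\sqcup V_2=\mathcal V(F),\ V_1<V_2}F|_{V_2}\otimes F|_{V_1},$$ where $V_1<V_2$ means that $y\not<x$ for all $x\in V_1$, $y\in V_2$, and where $F|_V$ keeps the edges joining two vertices of $V$. A covering subforest $G$ of $F$ is a partition of $\mathcal V(F)$ into connected blocks; it is also viewed as the forest obtained by keeping the edges of $F$ inside the blocks, and $F/G$ is the forest obtained by shrinking each block to one vertex, decorated by the sum in $\Omega$ of the decorations of the block. The covering-subforest coproduct is $$\Gamma(F)=\sum_{G\text{ covering subforest of }F}F/G\otimes G .$$ An arborescent mould is a linear map $M:\mathcal H^\Omega_<\to\mathcal A$, i.e. a family $(M^F)_F$ of elements of $\mathcal A$. **Operations.** For moulds, and likewise for arborescent moulds, define $M\times N$ and $M\diamond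 N$ by dualizing the corresponding coproducts $\Delta$ and $\Gamma$: $M\times N=m_{\mathcal A}\circ(M\otimes N)\circ\Delta$ and $M\diamond N=m_{\mathcal A}\circ(M\otimes N)\circ\Gamma$, where $m_{\mathcal A}$ is the multiplication of $\mathcal A$. **Contracting arborification.** Let $\mathfrak a:\mathcal H^\Omega_<\to\mathcal H^\Omega$ be the linear map $\mathfrak a(F)=\sum_{s}\sum_\sigma F^\sigma$, where $\sigma$ runs over the surjections $\mathcal V(F)\to\{1,\dots,s\}$ such that $\sigma(v)<\sigma(u)$ whenever $u<v$, and $F^\sigma$ is the word of length $s$ whose $j$-th letter is the sum in $\Omega$ of the decorations of the vertices $v$ with $\sigma(v)=j$. For a mould $M$ put $M_<=M\circ\mathfrak a$. **Theorem.** 1. The product $\times$ of arborescent moulds is associative. 2. The diamond composition $\diamond$ of arborescent moulds is associative. 3. The map $\mathfrak a$ is the unique linear map $\mathcal H^\Omega_<\to\mathcal H^\Omega$ that is a morphism of unital algebras (for the disjoint union and the quasi-shuffle product) and satisfies $\mathfrak a\circ B^b_+=L^b\circ\mathfrak a$ for all $b\in\Omega$. For all moulds $M,N$, $$(M\times N)_<=M_<\times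 N_<,\qquad (M\diamond N)_<=M_<\diamond N_< .$$ -/

import Mathlib

open scoped TensorProduct

universe u

section Words

/-! Words over the commutative semigroup `Ω`, their linear span `List Ω →₀ k`, the quasi-shuffle
product, deconcatenation, and the internal coproduct. -/

variable (k : Type*) [Field k] {Ω : Type*}

/-- The weight of a word: the sum of its letters. The empty word has no weight in `Ω`
(`none` plays the role of the extra element `0` of `Ω ⊔ {0}`). -/
def wordWeight [Add Ω] : List Ω → Option Ω
  | [] => none
  | a :: w => some (w.foldl (· + ·) a)

/-- The quasi-shuffle product of two words. -/
noncomputable def qsh [Add Ω] : List Ω → List Ω → (List Ω →₀ k)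
  | [], w => Finsupp.single w 1
  | a :: v, [] => Finsupp.single (a :: v) 1
  | a :: v, b :: w =>
      Finsupp.mapDomain (List.cons a) (qsh v (b :: w)) +
      Finsupp.mapDomain (List.cons b) (qsh (a :: v) w) +
      Finsupp.mapDomain (List.cons (a + b)) (qsh v w)
termination_by v w => v.length + w.length

/-- The quasi-shuffle product, extended bilinearly. -/
noncomputable def qshMul [Add Ω] :
    (List Ω →₀ k) →ₗ[k] (List Ω →₀ k) →ₗ[k] (List Ω →₀ k) :=
  Finsupp.linearCombination k fun v => Finsupp.linearCombination k (qsh k v)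

/-- The quasi-shuffle product of a finite sequence of words; the empty product is the empty
word. -/
noncomputable def qshList [Add Ω] : List (List Ω) → (List Ω →₀ k)
  | [] => Finsupp.single [] 1
  | v :: l => qshMul k (Finsupp.single v 1) (qshList l)

/-- The deconcatenation coproduct. -/
noncomputable def wordDelta :
    (List Ω →₀ k) →ₗ[k] (List Ω →₀ k) ⊗[k] (List Ω →₀ k) :=
  Finsupp.linearCombination k fun w =>
    ∑ i ∈ Finset.range (w.length + 1),
      Finsupp.single (w.take i) (1 : k) ⊗ₜ[k] Finsupp.single (w.drop i) (1 : k)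

/-- The internal (decomposition) coproduct: the sum, over all the ways to cut `w` into nonempty
blocks `w¹ … wˢ`, of the word of the block weights tensored with the quasi-shuffle product of the
blocks. The empty word has exactly one decomposition, with `s = 0`. -/
noncomputable def wordGamma [Add Ω] :
    (List Ω →₀ k) →ₗ[k] (List Ω →₀ k) ⊗[k] (List Ω →₀ k) :=
  Finsupp.linearCombination k fun w =>
    ∑ c : Composition w.length,
      Finsupp.single ((w.splitWrtComposition c).filterMap wordWeight) (1 : k) ⊗ₜ[k]
        qshList k (w.splitWrtComposition c)

/-- The operator `L^b : w ↦ wb`. -/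
noncomputable def wordAppend (b : Ω) : (List Ω →₀ k) →ₗ[k] (List Ω →₀ k) :=
  Finsupp.lmapDomain k k fun w => w ++ [b]

end Words

section WeightSum

/-- The sum, in a commutative semigroup, of a nonempty finite family is an element of the
semigroup. -/
theorem sum_coe_ne_zero {Ω ι : Type*} [AddCommSemigroup Ω] (s : Finset ι) (hs : s.Nonempty)
    (d : ι → Ω) : (∑ i ∈ s, (d i : WithZero Ω)) ≠ 0 := by
  suffices h : ∃ a : Ω, (a : WithZero Ω) = ∑ i ∈ s, (d i : WithZero Ω) by
    obtain ⟨a, ha⟩ := h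
    rw [← ha]
    exact WithZero.coe_ne_zero
  classical
  induction hs using Finset.Nonempty.cons_induction with
  | singleton i => exact ⟨d i, by simp⟩
  | cons i s hi hs ih =>
    obtain ⟨a, ha⟩ := ih
    exact ⟨d i + a, by rw [Finset.sum_cons, ← ha, WithZero.coe_add]⟩

/-- The sum `[∑_{i ∈ s} d i]` in the semigroup `Ω` of a nonempty finite family. It is computed in
the monoid `Ω ⊔ {0}`. -/
def weightSum {Ω ι : Type*} [AddCommSemigroup Ω] (s : Finset ι) (hs : s.Nonempty) (d : ι → Ω) : Ω :=
  WithZero.unzero (x := ∑ i ∈ s, (d i : WithZero Ω)) (sum_coe_ne_zero s hs d)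

theorem coe_weightSum {Ω ι : Type*} [AddCommSemigroup Ω] (s : Finset ι) (hs : s.Nonempty)
    (d : ι → Ω) : ((weightSum s hs d : Ω) : WithZero Ω) = ∑ i ∈ s, (d i : WithZero Ω) :=
  WithZero.coe_unzero _

theorem weightSum_congr {Ω ι κ : Type*} [AddCommSemigroup Ω] {s : Finset ι} {t : Finset κ}
    (hs : s.Nonempty) (ht : t.Nonempty) {d : ι → Ω} {d' : κ → Ω} (e : ι ≃ κ)
    (hst : ∀ i, i ∈ s ↔ e i ∈ t) (hd : ∀ i, d i = d' (e i)) :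
    weightSum s hs d = weightSum t ht d' := by
  apply WithZero.coe_injective
  rw [coe_weightSum, coe_weightSum]
  exact Finset.sum_equiv e hst (fun i _ => by rw [hd i])

end WeightSum

/-- A rooted forest decorated by `Ω`: a finite oriented graph without oriented cycles, in which
every vertex has at most one incoming edge, with a decoration of its vertices.
`edge u v` means that there is an edge from `u` to `v` (`u` is the parent of `v`). -/
structure DecForest (Ω : Type u) where
  V : Type
  finite : Finite V
  edge : V → V → Prop
  acyclic : ∀ v, ¬ Relation.TransGen edge v v
  unique_parent : ∀ u u' v, edge u v → edge u' v → u = u'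
  dec : V → Ω

namespace DecForest

variable {Ω : Type u}

instance (F : DecForest Ω) : Finite F.V := F.finite

noncomputable instance (F : DecForest Ω) : Fintype F.V := Fintype.ofFinite _

/-- The strict order on the vertices: `u < v` when an oriented path leads from `u` to `v`.
The roots are the minimal vertices. -/
def lt (F : DecForest Ω) (u v : F.V) : Prop := Relation.TransGen F.edge u v

/-- A root is a vertex without incoming edge. -/
def IsRoot (F : DecForest Ω) (v : F.V) : Prop := ∀ u, ¬ F.edge u v

/-- `e` is an isomorphism of decorated rooted forests. -/
structure IsIso (F G : DecForest Ω) (e : F.V ≃ G.V) : Prop where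
  edge_iff : ∀ u v, F.edge u v ↔ G.edge (e u) (e v)
  dec_eq : ∀ v, F.dec v = G.dec (e v)

theorem IsIso.symm {F G : DecForest Ω} {e : F.V ≃ G.V} (h : IsIso F G e) : IsIso G F e.symm where
  edge_iff u v := by rw [h.edge_iff]; simp
  dec_eq v := by rw [h.dec_eq]; simp

theorem IsIso.lt_iff {F G : DecForest Ω} {e : F.V ≃ G.V} (h : IsIso F G e) (u v : F.V) :
    F.lt u v ↔ G.lt (e u) (e v) := by
  constructor
  · intro huv
    exact Relation.TransGen.lift e (fun a b hab => (h.edge_iff a b).1 hab) _ _ huv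
  · intro huv
    have := Relation.TransGen.lift e.symm (fun a b hab => (h.symm.edge_iff a b).1 hab) _ _ huv
    simpa [lt, Function.onFun] using this

/-- Isomorphism of decorated rooted forests. -/
instance setoid (Ω : Type u) : Setoid (DecForest Ω) where
  r F G := ∃ e : F.V ≃ G.V, IsIso F G e
  iseqv :=
    { refl := fun _ => ⟨Equiv.refl _, ⟨fun _ _ => Iff.rfl, fun _ => rfl⟩⟩
      symm := fun ⟨e, h⟩ => ⟨e.symm, h.symm⟩
      trans := fun ⟨e, h⟩ ⟨e', h'⟩ => ⟨e.trans e',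
        ⟨fun u v => (h.edge_iff u v).trans (h'.edge_iff _ _),
          fun v => (h.dec_eq v).trans (h'.dec_eq _)⟩⟩ }

/-- The empty forest. -/
def empty (Ω : Type u) : DecForest Ω where
  V := Empty
  finite := inferInstance
  edge _ _ := False
  acyclic := nofun
  unique_parent := nofun
  dec v := v.elim

/-- The disjoint union of two forests. -/
def union (F G : DecForest Ω) : DecForest Ω where
  V := F.V ⊕ G.V
  finite := inferInstance
  edge := Sum.LiftRel F.edge G.edge
  acyclic := by
    have key : ∀ x y, Relation.TransGen (Sum.LiftRel F.edge G.edge) x y →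
        Sum.LiftRel (Relation.TransGen F.edge) (Relation.TransGen G.edge) x y := by
      intro x y h
      induction h with
      | single h => exact h.mono (fun _ _ => .single) (fun _ _ => .single)
      | tail _ h ih =>
        cases ih with
        | inl ih => cases h with
          | inl h => exact .inl (ih.tail h)
        | inr ih => cases h with
          | inr h => exact .inr (ih.tail h)
    intro v h
    cases key v v h with
    | inl h => exact F.acyclic _ h
    | inr h => exact G.acyclic _ h
  unique_parent := by
    intro u u' v h h'
    cases h with
    | inl h => cases h' with
      | inl h' => rw [F.unique_parent _ _ _ h h']
    | inr h => cases h' with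
      | inr h' => rw [G.unique_parent _ _ _ h h']
  dec := Sum.elim F.dec G.dec

/-- The tree `B_+^b(F)`: all the trees of `F` are grafted on a common new root (`none`), decorated
by `b`. -/
def graft (b : Ω) (F : DecForest Ω) : DecForest Ω where
  V := Option F.V
  finite := inferInstance
  edge u v := match u, v with
    | _, none => False
    | none, some v => F.IsRoot v
    | some u, some v => F.edge u v
  acyclic := by
    set E : Option F.V → Option F.V → Prop := fun u v => match u, v with
      | _, none => False
      | none, some v => F.IsRoot v
      | some u, some v => F.edge u v with hE
    have key : ∀ x y, Relation.TransGen E x y → ∃ v, y = some v ∧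
        ∀ u, x = some u → Relation.TransGen F.edge u v := by
      intro x y h
      induction h with
      | @single y h =>
        cases y with
        | none => cases x <;> exact h.elim
        | some v =>
          refine ⟨v, rfl, ?_⟩
          rintro u rfl
          exact .single h
      | @tail y z _ h ih =>
        obtain ⟨v, rfl, ih⟩ := ih
        cases z with
        | none => exact h.elim
        | some w => exact ⟨w, rfl, fun u hu => (ih u hu).tail h⟩
    intro x h
    obtain ⟨v, rfl, hv⟩ := key x x h
    exact F.acyclic v (hv v rfl)
  unique_parent := by
    intro u u' v h h'
    cases v with
    | none => cases u <;> exact h.elim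
    | some v =>
      cases u with
      | none => cases u' with
        | none => rfl
        | some u' => exact (h _ h').elim
      | some u => cases u' with
        | none => exact (h' _ h).elim
        | some u' => exact congrArg some (F.unique_parent _ _ _ h h')
  dec v := v.elim b F.dec

/-- The restriction of a forest to a set of vertices, keeping the edges that join two vertices of
the set. -/
def restrict (F : DecForest Ω) (S : Set F.V) : DecForest Ω where
  V := S
  finite := inferInstance
  edge u v := F.edge u v
  acyclic v h := F.acyclic v (Relation.TransGen.lift Subtype.val (fun _ _ h => h) _ _ h)
  unique_parent _ _ _ h h' := Subtype.ext (F.unique_parent _ _ _ h h')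
  dec v := F.dec v

/-- An admissible cut `(V₁, V₂)`, recorded by the set `V₁`; `V₂` is the complement of `V₁`. The
condition `V₁ < V₂` says that no vertex of `V₂` is smaller than a vertex of `V₁`. -/
abbrev AdmissibleCut (F : DecForest Ω) : Type :=
  {V₁ : Set F.V // ∀ x ∈ V₁, ∀ y ∈ V₁ᶜ, ¬ F.lt y x}

instance (F : DecForest Ω) : Finite F.AdmissibleCut := Subtype.finite

noncomputable instance (F : DecForest Ω) : Fintype F.AdmissibleCut := Fintype.ofFinite _

/-- A covering subforest: a partition of the vertices (given as an equivalence relation `r`) all of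
whose blocks are connected in the forest: any two vertices of a block are joined by a non-oriented
path of edges which remain in the block. -/
abbrev CoveringSubforest (F : DecForest Ω) : Type :=
  {r : Setoid F.V // ∀ u v, r u v → Relation.EqvGen (fun a b => F.edge a b ∧ r a b) u v}

instance (F : DecForest Ω) : Finite F.CoveringSubforest :=
  Finite.of_injective (fun (r : F.CoveringSubforest) (a b : F.V) => r.1 a b) fun _ _ h =>
    Subtype.ext (Setoid.ext fun a b => iff_of_eq (congrFun (congrFun h a) b))

noncomputable instance (F : DecForest Ω) : Fintype F.CoveringSubforest := Fintype.ofFinite _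

/-- A covering subforest, as a forest on the same vertices: the edges which join two vertices of
the same block are kept. -/
def subforest (F : DecForest Ω) (G : F.CoveringSubforest) : DecForest Ω where
  V := F.V
  finite := inferInstance
  edge u v := F.edge u v ∧ G.1 u v
  acyclic v h := F.acyclic v (Relation.TransGen.mono (fun _ _ h => h.1) _ _ h)
  unique_parent _ _ _ h h' := F.unique_parent _ _ _ h.1 h'.1
  dec := F.dec

/-- Two vertices in one block have a common lower bound inside the block. -/
theorem CoveringSubforest.exists_le (F : DecForest Ω) (G : F.CoveringSubforest) {u v : F.V}
    (h : G.1 u v) : ∃ w, Relation.ReflTransGen (F.subforest G).edge w u ∧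
      Relation.ReflTransGen (F.subforest G).edge w v := by
  have key : ∀ w x, Relation.ReflTransGen (F.subforest G).edge w x → ∀ w',
      Relation.ReflTransGen (F.subforest G).edge w' x →
      Relation.ReflTransGen (F.subforest G).edge w w' ∨
      Relation.ReflTransGen (F.subforest G).edge w' w := by
    intro w x hw
    induction hw with
    | refl => intro w' h; exact .inr h
    | tail hw hx ih =>
      intro w' hw'
      cases hw' with
      | refl => exact .inl (hw.tail hx)
      | tail hw' hx' =>
        have := (F.subforest G).unique_parent _ _ _ hx hx'
        subst this
        exact ih w' hw'
  have hE := G.2 u v h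
  clear h
  induction hE with
  | rel x y h => exact ⟨x, .refl, .single h⟩
  | refl x => exact ⟨x, .refl, .refl⟩
  | symm x y _ ih =>
    obtain ⟨w, h1, h2⟩ := ih
    exact ⟨w, h2, h1⟩
  | trans x y z _ _ ih1 ih2 =>
    obtain ⟨w, h1, h2⟩ := ih1
    obtain ⟨w', h1', h2'⟩ := ih2
    rcases key w y h2 w' h1' with h | h
    · exact ⟨w, h1, h.trans h2'⟩
    · exact ⟨w', h.trans h1, h2'⟩

/-- A vertex with a parent outside of its block is the smallest vertex of the block. -/
theorem CoveringSubforest.le_of_edge (F : DecForest Ω) (G : F.CoveringSubforest) {u v x : F.V}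
    (huv : F.edge u v) (hne : ¬ G.1 u v) (h : G.1 v x) :
    Relation.ReflTransGen (F.subforest G).edge v x := by
  obtain ⟨w, h1, h2⟩ := exists_le F G h
  cases h1 with
  | refl => exact h2
  | tail _ h =>
    have := F.unique_parent _ _ _ huv h.1
    subst this
    exact (hne h.2).elim

/-- The set of vertices of `F` in a given block is not empty. -/
theorem block_nonempty (F : DecForest Ω) (r : Setoid F.V) (c : Quotient r)
    [DecidablePred fun v : F.V => Quotient.mk r v = c] :
    (Finset.univ.filter fun v : F.V => Quotient.mk r v = c).Nonempty := by
  obtain ⟨v, hv⟩ := Quotient.exists_rep c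
  exact ⟨v, by simpa using hv⟩

open Classical in
/-- The contracted forest `F/G`: every block is shrunk to one vertex, decorated by the sum of the
decorations of the vertices of the block. -/
noncomputable def contract [AddCommSemigroup Ω] (F : DecForest Ω) (G : F.CoveringSubforest) :
    DecForest Ω where
  V := Quotient G.1
  finite := inferInstance
  edge c d := c ≠ d ∧ ∃ u v, F.edge u v ∧ Quotient.mk G.1 u = c ∧ Quotient.mk G.1 v = d
  acyclic := by
    have key : ∀ c d : Quotient G.1,
        Relation.TransGen (fun c d : Quotient G.1 => c ≠ d ∧
          ∃ u v, F.edge u v ∧ Quotient.mk G.1 u = c ∧ Quotient.mk G.1 v = d) c d →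
        ∃ u v, Quotient.mk G.1 u = c ∧ Quotient.mk G.1 v = d ∧ Relation.TransGen F.edge u v ∧
          ∀ x, G.1 v x → Relation.ReflTransGen F.edge v x := by
      have base : ∀ u v, Quotient.mk G.1 u ≠ Quotient.mk G.1 v → F.edge u v →
          ∀ x, G.1 v x → Relation.ReflTransGen F.edge v x := by
        intro u v hne huv x hx
        exact Relation.ReflTransGen.mono (fun _ _ h => h.1) _ _
          (CoveringSubforest.le_of_edge F G huv (fun h => hne (Quotient.sound h)) hx)
      intro c d h
      induction h with
      | single h =>
        obtain ⟨hne, u, v, huv, rfl, rfl⟩ := h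
        exact ⟨u, v, rfl, rfl, .single huv, base u v hne huv⟩
      | tail _ h ih =>
        obtain ⟨hne, u', w, huw, rfl, rfl⟩ := h
        obtain ⟨u, v, hu, hv, huv, hmin⟩ := ih
        refine ⟨u, w, hu, rfl, ?_, base u' w hne huw⟩
        exact (huv.trans_left (hmin u' (Quotient.exact hv))).tail huw
    intro c h
    obtain ⟨u, v, hu, hv, huv, hmin⟩ := key c c h
    exact F.acyclic u (huv.trans_left (hmin u (Quotient.exact (hv.trans hu.symm))))
  unique_parent := by
    rintro c c' d ⟨hne, u, v, huv, rfl, rfl⟩ ⟨hne', u', v', huv', rfl, hv'⟩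
    have h1 := CoveringSubforest.le_of_edge F G huv (fun h => hne (Quotient.sound h))
      (Quotient.exact hv'.symm)
    cases h1 with
    | refl => rw [F.unique_parent _ _ _ huv huv']
    | tail _ h =>
      have := F.unique_parent _ _ _ huv' h.1
      subst this
      exact (hne' ((Quotient.sound h.2).trans hv')).elim
  dec c := weightSum (Finset.univ.filter fun v : F.V => Quotient.mk G.1 v = c)
    (F.block_nonempty G.1 c) F.dec

/-- A linear extension with contractions of a forest: a surjective map `σ` from the vertices onto
`{1, …, s}` such that `σ v < σ u` whenever `u < v` (so the roots come last). -/
abbrev LinExt (F : DecForest Ω) (s : ℕ) : Type :=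
  {σ : F.V → Fin s // Function.Surjective σ ∧ ∀ u v, F.lt u v → σ v < σ u}

instance (F : DecForest Ω) (s : ℕ) : Finite (F.LinExt s) := Subtype.finite

noncomputable instance (F : DecForest Ω) (s : ℕ) : Fintype (F.LinExt s) := Fintype.ofFinite _

open Classical in
/-- The word `F^σ`, whose `j`-th letter is the sum of the decorations of the vertices `v` with
`σ v = j`. -/
noncomputable def extWord [AddCommSemigroup Ω] (F : DecForest Ω) {s : ℕ} (σ : F.LinExt s) :
    List Ω :=
  List.ofFn fun j : Fin s => weightSum (Finset.univ.filter fun v => σ.1 v = j)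
    (by obtain ⟨v, hv⟩ := σ.2.1 j; exact ⟨v, by simpa using hv⟩) F.dec

end DecForest

/-- Isomorphism classes of rooted forests decorated by `Ω`. -/
abbrev ForestClass (Ω : Type u) := Quotient (DecForest.setoid Ω)

namespace DecForest

variable {Ω : Type u}

/-- The isomorphism class of a forest. -/
def cls (F : DecForest Ω) : ForestClass Ω := Quotient.mk _ F

theorem cls_eq {F G : DecForest Ω} (e : F.V ≃ G.V) (h : IsIso F G e) : F.cls = G.cls :=
  Quotient.sound ⟨e, h⟩

theorem cls_union_congr {F F' G G' : DecForest Ω} (hF : F ≈ F') (hG : G ≈ G') :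
    (F.union G).cls = (F'.union G').cls := by
  obtain ⟨e, he⟩ := hF
  obtain ⟨e', he'⟩ := hG
  refine cls_eq (Equiv.sumCongr e e') ⟨?_, ?_⟩
  · rintro (u | u) (v | v)
    · exact Sum.liftRel_inl_inl.trans ((he.edge_iff u v).trans Sum.liftRel_inl_inl.symm)
    · exact iff_of_false Sum.not_liftRel_inl_inr Sum.not_liftRel_inl_inr
    · exact iff_of_false Sum.not_liftRel_inr_inl Sum.not_liftRel_inr_inl
    · exact Sum.liftRel_inr_inr.trans ((he'.edge_iff u v).trans Sum.liftRel_inr_inr.symm)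
  · rintro (v | v)
    · exact he.dec_eq v
    · exact he'.dec_eq v

theorem cls_graft_congr (b : Ω) {F F' : DecForest Ω} (hF : F ≈ F') :
    (F.graft b).cls = (F'.graft b).cls := by
  obtain ⟨e, he⟩ := hF
  have hroot : ∀ v, F.IsRoot v ↔ F'.IsRoot (e v) := by
    intro v
    constructor
    · intro h u hu
      refine h (e.symm u) ?_
      rw [he.edge_iff]
      simpa using hu
    · intro h u hu
      exact h _ ((he.edge_iff _ _).1 hu)
  refine cls_eq (Equiv.optionCongr e) ⟨?_, ?_⟩
  · rintro (_ | u) (_ | v)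
    · exact Iff.rfl
    · exact hroot v
    · exact Iff.rfl
    · exact he.edge_iff u v
  · rintro (_ | v)
    · rfl
    · exact he.dec_eq v

theorem cls_restrict_congr {F G : DecForest Ω} {e : F.V ≃ G.V} (h : IsIso F G e)
    (S : Set F.V) (T : Set G.V) (hST : ∀ v, v ∈ S ↔ e v ∈ T) :
    (F.restrict S).cls = (G.restrict T).cls :=
  cls_eq (F := F.restrict S) (G := G.restrict T) (e.subtypeEquiv hST)
    ⟨fun _ _ => h.edge_iff _ _, fun _ => h.dec_eq _⟩

/-- Admissible cuts are transported by isomorphisms. -/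
def cutEquiv {F G : DecForest Ω} {e : F.V ≃ G.V} (h : IsIso F G e) :
    F.AdmissibleCut ≃ G.AdmissibleCut :=
  (Equiv.Set.congr e).subtypeEquiv fun S => by
    constructor
    · rintro hS _ ⟨x, hx, rfl⟩ y hy hlt
      obtain ⟨y, rfl⟩ := e.surjective y
      exact hS x hx y (fun hyS => hy ⟨y, hyS, rfl⟩) ((h.lt_iff _ _).2 hlt)
    · intro hT x hx y hy hlt
      refine hT (e x) ⟨x, hx, rfl⟩ (e y) ?_ ((h.lt_iff _ _).1 hlt)
      rintro ⟨y', hy', hyy'⟩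
      exact hy (e.injective hyy' ▸ hy')

theorem covering_map {F G : DecForest Ω} {e : F.V ≃ G.V} (h : IsIso F G e)
    (r : F.CoveringSubforest) (u v : G.V) (huv : r.1.comap e.symm u v) :
    Relation.EqvGen (fun a b => G.edge a b ∧ r.1.comap e.symm a b) u v := by
  have key : ∀ x y, Relation.EqvGen (fun a b => F.edge a b ∧ r.1 a b) x y →
      Relation.EqvGen (fun a b => G.edge a b ∧ r.1.comap e.symm a b) (e x) (e y) := by
    intro x y hxy
    induction hxy with
    | rel x y hxy =>
      refine .rel _ _ ⟨(h.edge_iff _ _).1 hxy.1, ?_⟩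
      rw [Setoid.comap_rel]
      simpa using hxy.2
    | refl x => exact .refl _
    | symm x y _ ih => exact .symm _ _ ih
    | trans x y z _ _ ih1 ih2 => exact .trans _ _ _ ih1 ih2
  simpa using key _ _ (r.2 _ _ huv)

/-- Covering subforests are transported by isomorphisms. -/
def coveringEquiv {F G : DecForest Ω} {e : F.V ≃ G.V} (h : IsIso F G e) :
    F.CoveringSubforest ≃ G.CoveringSubforest where
  toFun r := ⟨r.1.comap e.symm, covering_map h r⟩
  invFun r := ⟨r.1.comap e.symm.symm, covering_map h.symm r⟩
  left_inv r := Subtype.ext (Setoid.ext fun a b => by simp [Setoid.comap_rel])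
  right_inv r := Subtype.ext (Setoid.ext fun a b => by simp [Setoid.comap_rel])

theorem coveringEquiv_rel {F G : DecForest Ω} {e : F.V ≃ G.V} (h : IsIso F G e)
    (r : F.CoveringSubforest) (u v : F.V) :
    r.1 u v ↔ (coveringEquiv h r).1 (e u) (e v) := by
  change r.1 u v ↔ r.1 (e.symm (e u)) (e.symm (e v))
  rw [e.symm_apply_apply, e.symm_apply_apply]

theorem cls_subforest_congr {F G : DecForest Ω} {e : F.V ≃ G.V} (h : IsIso F G e)
    (r : F.CoveringSubforest) :
    (F.subforest r).cls = (G.subforest (coveringEquiv h r)).cls :=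
  cls_eq (F := F.subforest r) (G := G.subforest _) e
    ⟨fun u v => and_congr (h.edge_iff u v) (coveringEquiv_rel h r u v), fun v => h.dec_eq v⟩

theorem cls_contract_congr [AddCommSemigroup Ω] {F G : DecForest Ω} {e : F.V ≃ G.V}
    (h : IsIso F G e) (r : F.CoveringSubforest) :
    (F.contract r).cls = (G.contract (coveringEquiv h r)).cls := by
  set E : Quotient r.1 ≃ Quotient (coveringEquiv h r).1 :=
    Quotient.congr e (coveringEquiv_rel h r) with hE
  have hmk : ∀ v, E (Quotient.mk r.1 v) = Quotient.mk (coveringEquiv h r).1 (e v) := fun v => rfl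
  have hb : ∀ (c : Quotient r.1) v,
      Quotient.mk r.1 v = c ↔ Quotient.mk (coveringEquiv h r).1 (e v) = E c := fun c v => by
    rw [← hmk, E.injective.eq_iff]
  refine cls_eq (F := F.contract r) (G := G.contract _) E ⟨?_, ?_⟩
  · intro c d
    refine and_congr (not_congr E.injective.eq_iff.symm) ?_
    constructor
    · rintro ⟨u, v, huv, rfl, rfl⟩
      exact ⟨e u, e v, (h.edge_iff _ _).1 huv, rfl, rfl⟩
    · rintro ⟨u, v, huv, hu, hv⟩
      obtain ⟨u, rfl⟩ := e.surjective u
      obtain ⟨v, rfl⟩ := e.surjective v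
      exact ⟨u, v, (h.edge_iff _ _).2 huv, E.injective hu, E.injective hv⟩
  · intro c
    unfold contract
    dsimp only
    apply weightSum_congr
    · intro v
      simpa using hb c v
    · exact h.dec_eq

/-- Linear extensions are transported by isomorphisms. -/
def linExtEquiv {F G : DecForest Ω} {e : F.V ≃ G.V} (h : IsIso F G e) (s : ℕ) :
    F.LinExt s ≃ G.LinExt s :=
  (Equiv.arrowCongr e (Equiv.refl _)).subtypeEquiv fun σ => by
    refine and_congr ?_ ?_
    · exact (e.symm.surjective.of_comp_iff σ).symm
    · constructor
      · intro hσ u v huv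
        exact hσ _ _ ((h.symm.lt_iff u v).1 huv)
      · intro hσ u v huv
        simpa using hσ _ _ ((h.lt_iff u v).1 huv)

theorem extWord_congr [AddCommSemigroup Ω] {F G : DecForest Ω} {e : F.V ≃ G.V}
    (h : IsIso F G e) {s : ℕ} (σ : F.LinExt s) :
    F.extWord σ = G.extWord (linExtEquiv h s σ) := by
  refine congrArg List.ofFn (funext fun j => weightSum_congr _ _ e (fun v => ?_) h.dec_eq)
  have : (linExtEquiv h s σ).1 (e v) = σ.1 v := congrArg σ.1 (e.symm_apply_apply v)
  simp [this]

end DecForest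

section Forests

/-! The linear span `ForestClass Ω →₀ k` of decorated rooted forests. -/

variable (k : Type*) [Field k] {Ω : Type u}

/-- The commutative product of forests (disjoint union), extended bilinearly. -/
noncomputable def forestMul :
    (ForestClass Ω →₀ k) →ₗ[k] (ForestClass Ω →₀ k) →ₗ[k] (ForestClass Ω →₀ k) :=
  Finsupp.linearCombination k fun x => Finsupp.linearCombination k fun y =>
    Finsupp.single (Quotient.liftOn₂ x y (fun F G => (F.union G).cls)
      fun _ _ _ _ h h' => DecForest.cls_union_congr h h') 1

/-- The grafting operator `B_+^b`. -/
noncomputable def forestGraft (b : Ω) : (ForestClass Ω →₀ k) →ₗ[k] (ForestClass Ω →₀ k) :=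
  Finsupp.lmapDomain k k fun x =>
    Quotient.liftOn x (fun F => (F.graft b).cls) fun _ _ h => DecForest.cls_graft_congr b h

/-- The admissible-cut coproduct `Δ(F) = ∑ F|V₂ ⊗ F|V₁`. -/
noncomputable def forestDelta :
    (ForestClass Ω →₀ k) →ₗ[k] (ForestClass Ω →₀ k) ⊗[k] (ForestClass Ω →₀ k) :=
  Finsupp.linearCombination k fun x => Quotient.liftOn x
    (fun F => ∑ C : F.AdmissibleCut,
      Finsupp.single (F.restrict C.1ᶜ).cls (1 : k) ⊗ₜ[k]
        Finsupp.single (F.restrict C.1).cls (1 : k))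
    (by
      rintro F G ⟨e, h⟩
      refine Fintype.sum_equiv (DecForest.cutEquiv h) _ _ fun C => ?_
      have hC : ∀ v, v ∈ C.1 ↔ e v ∈ (DecForest.cutEquiv h C).1 := fun v =>
        (e.injective.mem_set_image (s := C.1)).symm
      rw [DecForest.cls_restrict_congr h C.1 _ hC,
        DecForest.cls_restrict_congr h C.1ᶜ (DecForest.cutEquiv h C).1ᶜ fun v => not_congr (hC v)])

/-- The covering-subforest (extraction-contraction) coproduct `Γ(F) = ∑ F/G ⊗ G`. -/
noncomputable def forestGamma [AddCommSemigroup Ω] :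
    (ForestClass Ω →₀ k) →ₗ[k] (ForestClass Ω →₀ k) ⊗[k] (ForestClass Ω →₀ k) :=
  Finsupp.linearCombination k fun x => Quotient.liftOn x
    (fun F => ∑ G : F.CoveringSubforest,
      Finsupp.single (F.contract G).cls (1 : k) ⊗ₜ[k]
        Finsupp.single (F.subforest G).cls (1 : k))
    (by
      rintro F G ⟨e, h⟩
      refine Fintype.sum_equiv (DecForest.coveringEquiv h) _ _ fun r => ?_
      rw [DecForest.cls_contract_congr h, DecForest.cls_subforest_congr h])

/-- The contracting arborification: the image of a forest is the sum of all its linear extensions,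
with contractions allowed. (There is no surjection onto `{1, …, s}` when `s` is larger than the
number of vertices.) -/
noncomputable def arborification [AddCommSemigroup Ω] :
    (ForestClass Ω →₀ k) →ₗ[k] (List Ω →₀ k) :=
  Finsupp.linearCombination k fun x => Quotient.liftOn x
    (fun F => ∑ s ∈ Finset.range (Nat.card F.V + 1), ∑ σ : F.LinExt s,
      Finsupp.single (F.extWord σ) (1 : k))
    (by
      rintro F G ⟨e, h⟩
      change (∑ s ∈ _, ∑ σ : F.LinExt s, _) = ∑ s ∈ _, ∑ σ : G.LinExt s, _
      rw [Nat.card_congr e]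
      refine Finset.sum_congr rfl fun s _ => ?_
      refine Fintype.sum_equiv (DecForest.linExtEquiv h s) _ _ fun σ => ?_
      rw [DecForest.extWord_congr h])

/-- The properties which characterize the contracting arborification: it is a morphism of unital
algebras, from forests with the disjoint union to words with the quasi-shuffle product, and it
turns `B_+^b` into `L^b`. -/
structure IsContractingArborification [AddCommSemigroup Ω]
    (a : (ForestClass Ω →₀ k) →ₗ[k] (List Ω →₀ k)) : Prop where
  map_one : a (Finsupp.single (DecForest.empty Ω).cls 1) = Finsupp.single [] 1
  map_mul : ∀ x y, a (forestMul k x y) = qshMul k (a x) (a y)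
  map_graft : ∀ b x, a (forestGraft k b x) = wordAppend k b (a x)

end Forests

section Moulds

variable {k : Type*} [Field k] {A : Type*} [CommRing A] [Algebra k A]

/-- The product `(M, N) ↦ (M ⊗ N) ∘ δ` of linear maps with values in the commutative algebra `A`
obtained by dualizing the coproduct `δ`. -/
noncomputable def dualProduct {H : Type*} [AddCommGroup H] [Module k H] (δ : H →ₗ[k] H ⊗[k] H)
    (M N : H →ₗ[k] A) : H →ₗ[k] A :=
  LinearMap.mul' k A ∘ₗ TensorProduct.map M N ∘ₗ δ

variable (k A) in
/-- An (ordinary) `A`-valued mould on `Ω`: a linear map on the span of the words. -/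
abbrev Mould (Ω : Type*) := (List Ω →₀ k) →ₗ[k] A

variable (k A) in
/-- An `A`-valued arborescent mould on `Ω`: a linear map on the span of the decorated forests, that
is, a family `(M^F)` of elements of `A` indexed by the (isomorphism classes of) forests. -/
abbrev ArbMould (Ω : Type u) := (ForestClass Ω →₀ k) →ₗ[k] A

/-- The product `M × N` of ordinary moulds. -/
noncomputable def Mould.prod {Ω : Type*} (M N : Mould k A Ω) : Mould k A Ω :=
  dualProduct (wordDelta k) M N

/-- The diamond composition `M ⋄ N` of ordinary moulds. -/
noncomputable def Mould.diamond {Ω : Type*} [Add Ω] (M N : Mould k A Ω) : Mould k A Ω :=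
  dualProduct (wordGamma k) M N

/-- The product `M × N` of arborescent moulds, dual to the admissible-cut coproduct. -/
noncomputable def ArbMould.prod {Ω : Type u} (M N : ArbMould k A Ω) : ArbMould k A Ω :=
  dualProduct (forestDelta k) M N

/-- The diamond composition `M ⋄ N` of arborescent moulds, dual to the covering-subforest
coproduct. -/
noncomputable def ArbMould.diamond {Ω : Type u} [AddCommSemigroup Ω] (M N : ArbMould k A Ω) :
    ArbMould k A Ω :=
  dualProduct (forestGamma k) M N

/-- The arborified mould `M_< = M ∘ 𝔞`. -/
noncomputable def Mould.arborify {Ω : Type u} [AddCommSemigroup Ω] (M : Mould k A Ω) :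
    ArbMould k A Ω :=
  M ∘ₗ arborification k

end Moulds

universe v

section MouldOperations

variable {k : Type*} [Field k] {A : Type*} [CommRing A] [Algebra k A] {Ω : Type u}

theorem forest_hom_ext {B : Type*} [AddCommMonoid B] [Module k B]
    {f g : (ForestClass Ω →₀ k) →ₗ[k] B}
    (h : ∀ F : DecForest Ω, f (Finsupp.single F.cls 1) = g (Finsupp.single F.cls 1)) : f = g := by
  refine Finsupp.lhom_ext' fun x => LinearMap.ext_ring ?_
  induction x using Quotient.inductionOn with
  | h F => exact h F

theorem forestDelta_single (F : DecForest Ω) :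
    forestDelta k (Finsupp.single F.cls 1) = ∑ C : F.AdmissibleCut,
      Finsupp.single (F.restrict C.1ᶜ).cls (1 : k) ⊗ₜ[k]
        Finsupp.single (F.restrict C.1).cls (1 : k) := by
  rw [forestDelta, Finsupp.linearCombination_single, one_smul]
  rfl

theorem forestGamma_single [AddCommSemigroup Ω] (F : DecForest Ω) :
    forestGamma k (Finsupp.single F.cls 1) = ∑ G : F.CoveringSubforest,
      Finsupp.single (F.contract G).cls (1 : k) ⊗ₜ[k]
        Finsupp.single (F.subforest G).cls (1 : k) := by
  rw [forestGamma, Finsupp.linearCombination_single, one_smul]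
  rfl

theorem arborification_single [AddCommSemigroup Ω] (F : DecForest Ω) :
    arborification k (Finsupp.single F.cls 1) =
      ∑ s ∈ Finset.range (Nat.card F.V + 1), ∑ σ : F.LinExt s,
        Finsupp.single (F.extWord σ) (1 : k) := by
  rw [arborification, Finsupp.linearCombination_single, one_smul]
  rfl

theorem ArbMould.prod_single (M N : ArbMould k A Ω) (F : DecForest Ω) :
    ArbMould.prod M N (Finsupp.single F.cls 1) = ∑ C : F.AdmissibleCut,
      M (Finsupp.single (F.restrict C.1ᶜ).cls 1) * N (Finsupp.single (F.restrict C.1).cls 1) := by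
  rw [ArbMould.prod, dualProduct, LinearMap.comp_apply, LinearMap.comp_apply, forestDelta_single]
  simp

theorem ArbMould.diamond_single [AddCommSemigroup Ω] (M N : ArbMould k A Ω) (F : DecForest Ω) :
    ArbMould.diamond M N (Finsupp.single F.cls 1) = ∑ G : F.CoveringSubforest,
      M (Finsupp.single (F.contract G).cls 1) * N (Finsupp.single (F.subforest G).cls 1) := by
  rw [ArbMould.diamond, dualProduct, LinearMap.comp_apply, LinearMap.comp_apply,
    forestGamma_single]
  simp

end MouldOperations

theorem eqvGen_imp {α : Type*} {r s : α → α → Prop} (h : ∀ a b, r a b → s a b) {a b : α}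
    (hab : Relation.EqvGen r a b) : Relation.EqvGen s a b :=
  Relation.EqvGen.mono h a b hab

theorem rel_of_eqvGen {α : Type*} {r : α → α → Prop} (s : Setoid α) (h : ∀ a b, r a b → s a b)
    {a b : α} (hab : Relation.EqvGen r a b) : s a b := by
  induction hab with
  | rel a b hab => exact h a b hab
  | refl a => exact s.refl a
  | symm a b _ ih => exact s.symm ih
  | trans a b c _ _ ih ih' => exact s.trans ih ih'

theorem sum_ite_of_fiberwise {α Q B : Type*} [AddCommMonoid B] [Fintype α] [Fintype Q]
    [DecidableEq Q] (π : α → Q) (p : Q → Prop) [DecidablePred p] (d : Q → B) (f : α → B)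
    (hd : ∀ q, d q = ∑ a, if π a = q then f a else 0) :
    (∑ q, if p q then d q else 0) = ∑ a, if p (π a) then f a else 0 := by
  calc (∑ q, if p q then d q else 0)
      = ∑ q, ∑ a, if π a = q then (if p q then f a else 0) else 0 := by
        refine Finset.sum_congr rfl fun q _ => ?_
        rw [hd]
        split_ifs
        · rfl
        · simp
    _ = _ := by
        rw [Finset.sum_comm]
        refine Finset.sum_congr rfl fun a _ => ?_
        rw [Finset.sum_ite_eq, if_pos (Finset.mem_univ _)]

/-- Reversal of the order of summation, over pairs in relation, in terms of parametrizations of the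
sections of the relation. -/
theorem sum_comm_of_equiv {α B : Type*} [AddCommMonoid B] [Fintype α] {X Y : α → Type*}
    [∀ a, Fintype (X a)] [∀ a, Fintype (Y a)] (p : α → α → Prop)
    (e : ∀ a, {b // p a b} ≃ X a) (e' : ∀ b, {a // p a b} ≃ Y b)
    (f : ∀ a, X a → B) (g : ∀ b, Y b → B)
    (h : ∀ a b (hab : p a b), f a (e a ⟨b, hab⟩) = g b (e' b ⟨a, hab⟩)) :
    ∑ a, ∑ x, f a x = ∑ b, ∑ y, g b y := by
  classical
  have h₁ : ∀ a, ∑ x, f a x = ∑ b : {b // p a b}, f a (e a b) := fun a =>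
    ((e a).sum_comp (f a)).symm
  have h₂ : ∀ b, ∑ y, g b y = ∑ a : {a // p a b}, g b (e' b a) := fun b =>
    ((e' b).sum_comp (g b)).symm
  rw [Finset.sum_congr rfl fun a _ => h₁ a, Finset.sum_congr rfl fun b _ => h₂ b,
    ← Fintype.sum_sigma', ← Fintype.sum_sigma']
  exact Fintype.sum_equiv
    { toFun := fun x => ⟨x.2.1, x.1, x.2.2⟩
      invFun := fun x => ⟨x.2.1, x.1, x.2.2⟩
      left_inv := fun _ => rfl
      right_inv := fun _ => rfl } _ _ fun x => h x.1 x.2.1 x.2.2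

namespace DecForest

variable {Ω : Type u}

theorem admissible_iff (F : DecForest Ω) (S : Set F.V) :
    (∀ x ∈ S, ∀ y ∈ Sᶜ, ¬ F.lt y x) ↔ ∀ x y, F.edge y x → x ∈ S → y ∈ S := by
  constructor
  · intro h x y hyx hx
    by_contra hy
    exact h x hx y hy (.single hyx)
  · intro h x hx y hy hyx
    refine hy ?_
    induction hyx using Relation.TransGen.head_induction_on with
    | single hyx => exact h _ _ hyx hx
    | head hyz _ ih =>
      by_contra hy'
      exact hy' (h _ _ hyz (by_contra fun hz => hz (ih hz)))

theorem AdmissibleCut.mem_of_edge {F : DecForest Ω} (C : F.AdmissibleCut) {x y : F.V}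
    (h : F.edge y x) (hx : x ∈ C.1) : y ∈ C.1 :=
  (F.admissible_iff C.1).1 C.2 x y h hx

/-- The admissible cuts of the upper part of a cut. -/
def cutUpperEquiv (F : DecForest Ω) (C : F.AdmissibleCut) :
    {D : F.AdmissibleCut // C.1 ⊆ D.1} ≃ (F.restrict C.1ᶜ).AdmissibleCut where
  toFun D := ⟨Subtype.val ⁻¹' D.1.1, ((F.restrict C.1ᶜ).admissible_iff _).2 fun x y h hx =>
    D.1.mem_of_edge (show F.edge y.1 x.1 from h) hx⟩
  invFun E := ⟨⟨C.1 ∪ {v | ∃ h : v ∈ C.1ᶜ, (⟨v, h⟩ : (C.1ᶜ : Set F.V)) ∈ E.1},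
      (F.admissible_iff _).2 (by
        rintro x y h (hx | ⟨hx, hxE⟩)
        · exact .inl (C.mem_of_edge h hx)
        · by_cases hy : y ∈ C.1
          · exact .inl hy
          · exact .inr ⟨hy, E.mem_of_edge (F := F.restrict C.1ᶜ) (x := ⟨x, hx⟩) (y := ⟨y, hy⟩) h hxE⟩)⟩,
    Set.subset_union_left⟩
  left_inv D := by
    refine Subtype.ext (Subtype.ext (Set.ext fun v => ?_))
    constructor
    · rintro (hv | ⟨_, hv⟩)
      · exact D.2 hv
      · exact hv
    · intro hv
      by_cases h : v ∈ C.1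
      · exact .inl h
      · exact .inr ⟨h, hv⟩
  right_inv E := by
    refine Subtype.ext (Set.ext fun v => ?_)
    constructor
    · rintro (hv | ⟨_, hv⟩)
      · exact (v.2 hv).elim
      · exact hv
    · intro hv
      exact .inr ⟨v.2, hv⟩

/-- The admissible cuts of the lower part of a cut. -/
def cutLowerEquiv (F : DecForest Ω) (D : F.AdmissibleCut) :
    {C : F.AdmissibleCut // C.1 ⊆ D.1} ≃ (F.restrict D.1).AdmissibleCut where
  toFun C := ⟨Subtype.val ⁻¹' C.1.1, ((F.restrict D.1).admissible_iff _).2 fun x y h hx =>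
    C.1.mem_of_edge (show F.edge y.1 x.1 from h) hx⟩
  invFun E := ⟨⟨{v | ∃ h : v ∈ D.1, (⟨v, h⟩ : D.1) ∈ E.1},
      (F.admissible_iff _).2 (by
        rintro x y h ⟨hx, hxE⟩
        exact ⟨D.mem_of_edge h hx,
          E.mem_of_edge (F := F.restrict D.1) (x := ⟨x, hx⟩) (y := ⟨y, D.mem_of_edge h hx⟩) h hxE⟩)⟩,
    fun _ h => h.1⟩
  left_inv C := by
    refine Subtype.ext (Subtype.ext (Set.ext fun v => ?_))
    exact ⟨fun h => h.2, fun h => ⟨C.2 h, h⟩⟩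
  right_inv E := by
    refine Subtype.ext (Set.ext fun v => ?_)
    exact ⟨fun h => h.2, fun h => ⟨v.2, h⟩⟩

theorem cls_restrict_restrict (F : DecForest Ω) (S : Set F.V) (T : Set (F.restrict S).V)
    (U : Set F.V) (hU : ∀ v, v ∈ U ↔ ∃ h : v ∈ S, (⟨v, h⟩ : S) ∈ T) :
    ((F.restrict S).restrict T).cls = (F.restrict U).cls := by
  refine cls_eq (F := (F.restrict S).restrict T) (G := F.restrict U)
    { toFun := fun v => ⟨v.1.1, (hU _).2 ⟨v.1.2, v.2⟩⟩
      invFun := fun v => ⟨⟨v.1, ((hU _).1 v.2).1⟩, ((hU _).1 v.2).2⟩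
      left_inv := fun _ => rfl
      right_inv := fun _ => rfl } ⟨fun _ _ => Iff.rfl, fun _ => rfl⟩

/-- The coarsening of a covering subforest, seen in the contracted forest. -/
def coveringContractEquiv [AddCommSemigroup Ω] (F : DecForest Ω) (G : F.CoveringSubforest) :
    {G' : F.CoveringSubforest // G.1 ≤ G'.1} ≃ (F.contract G).CoveringSubforest where
  toFun G' := ⟨Setoid.ker (Quotient.lift (Quotient.mk G'.1.1) fun _ _ h => Quotient.sound (G'.2 h)),
    by
      have key : ∀ u v, Relation.EqvGen (fun a b => F.edge a b ∧ G'.1.1 a b) u v →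
          Relation.EqvGen (fun c d => (F.contract G).edge c d ∧
            Setoid.ker (Quotient.lift (Quotient.mk G'.1.1) fun _ _ h => Quotient.sound (G'.2 h))
              c d) (Quotient.mk G.1 u) (Quotient.mk G.1 v) := by
        intro u v h
        induction h with
        | rel u v h =>
          by_cases huv : Quotient.mk G.1 u = Quotient.mk G.1 v
          · rw [huv]; exact .refl _
          · exact .rel _ _ ⟨⟨huv, u, v, h.1, rfl, rfl⟩, Quotient.sound (s := G'.1.1) h.2⟩
        | refl u => exact .refl _
        | symm u v _ ih => exact .symm _ _ ih
        | trans u v w _ _ ih ih' => exact .trans _ _ _ ih ih'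
      intro c d
      induction c, d using Quotient.inductionOn₂ with
      | h u v => exact fun h => key u v (G'.1.2 u v (Quotient.exact h))⟩
  invFun H := ⟨⟨H.1.comap (Quotient.mk G.1), by
      have mono : ∀ u v, G.1 u v →
          Relation.EqvGen (fun a b => F.edge a b ∧ H.1.comap (Quotient.mk G.1) a b) u v := by
        intro u v h
        refine eqvGen_imp (fun a b h => ⟨h.1, ?_⟩) (G.2 u v h)
        change H.1 (Quotient.mk G.1 a) (Quotient.mk G.1 b)
        rw [Quotient.sound h.2]
        exact H.1.refl _
      have key : ∀ c d, Relation.EqvGen (fun c d => (F.contract G).edge c d ∧ H.1 c d) c d →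
          ∀ u v, Quotient.mk G.1 u = c → Quotient.mk G.1 v = d →
          Relation.EqvGen (fun a b => F.edge a b ∧ H.1.comap (Quotient.mk G.1) a b) u v := by
        intro c d h
        induction h with
        | rel c d h =>
          intro u v hu hv
          obtain ⟨⟨-, u', v', h', hu', hv'⟩, hcd⟩ := h
          refine .trans _ _ _ (mono u u' (Quotient.exact (hu.trans hu'.symm)))
            (.trans _ _ _ (.rel _ _ ⟨h', ?_⟩) (mono v' v (Quotient.exact (hv'.trans hv.symm))))
          change H.1 (Quotient.mk G.1 u') (Quotient.mk G.1 v')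
          rw [hu', hv']
          exact hcd
        | refl c => exact fun u v hu hv => mono u v (Quotient.exact (hu.trans hv.symm))
        | symm c d _ ih => exact fun u v hu hv => .symm _ _ (ih v u hv hu)
        | trans c d e _ _ ih ih' =>
          intro u v hu hv
          obtain ⟨w, hw⟩ := Quotient.exists_rep d
          exact .trans _ _ _ (ih u w hu hw) (ih' w v hw hv)
      exact fun u v h => key _ _ (H.2 _ _ h) u v rfl rfl⟩,
    fun u v h => by
      change H.1 (Quotient.mk G.1 u) (Quotient.mk G.1 v)
      rw [Quotient.sound h]
      exact H.1.refl _⟩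
  left_inv G' := Subtype.ext (Subtype.ext (Setoid.ext fun u v =>
    Quotient.eq (r := G'.1.1)))
  right_inv H := by
    refine Subtype.ext (Setoid.ext fun c d => ?_)
    induction c, d using Quotient.inductionOn₂ with
    | h u v => exact Quotient.eq (r := H.1.comap (Quotient.mk G.1))

theorem coveringContractEquiv_mk [AddCommSemigroup Ω] (F : DecForest Ω) (G : F.CoveringSubforest)
    (G' : {G' : F.CoveringSubforest // G.1 ≤ G'.1}) (u v : F.V) :
    (F.coveringContractEquiv G G').1 (Quotient.mk G.1 u) (Quotient.mk G.1 v) ↔ G'.1.1 u v :=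
  Quotient.eq (r := G'.1.1)

/-- The refinements of a covering subforest are its own covering subforests. -/
def coveringSubforestEquiv (F : DecForest Ω) (G' : F.CoveringSubforest) :
    {G : F.CoveringSubforest // G.1 ≤ G'.1} ≃ (F.subforest G').CoveringSubforest where
  toFun G := ⟨G.1.1, fun u v h => eqvGen_imp
    (fun _ _ h => ⟨⟨h.1, G.2 h.2⟩, h.2⟩) (G.1.2 u v h)⟩
  invFun K := ⟨⟨K.1, fun u v h => eqvGen_imp (fun _ _ h => ⟨h.1.1, h.2⟩) (K.2 u v h)⟩,
    fun u v h => rel_of_eqvGen G'.1 (fun _ _ h => h.1.2) (K.2 u v h)⟩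
  left_inv _ := rfl
  right_inv _ := rfl

theorem cls_subforest_subforest (F : DecForest Ω) (G' : F.CoveringSubforest)
    (G : {G : F.CoveringSubforest // G.1 ≤ G'.1}) :
    ((F.subforest G').subforest (F.coveringSubforestEquiv G' G)).cls = (F.subforest G.1).cls :=
  cls_eq (F := (F.subforest G').subforest _) (G := F.subforest G.1) (Equiv.refl _)
    ⟨fun u v => (⟨fun h => ⟨h.1.1, h.2⟩, fun h => ⟨⟨h.1, G.2 h.2⟩, h.2⟩⟩ :
      (F.edge u v ∧ G'.1 u v) ∧ G.1.1 u v ↔ F.edge u v ∧ G.1.1 u v), fun _ => rfl⟩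

theorem cls_subforest_contract [AddCommSemigroup Ω] (F : DecForest Ω) (G G' : F.CoveringSubforest)
    (h : G.1 ≤ G'.1) :
    ((F.contract G).subforest (F.coveringContractEquiv G ⟨G', h⟩)).cls =
      ((F.subforest G').contract (F.coveringSubforestEquiv G' ⟨G, h⟩)).cls := by
  refine cls_eq (F := (F.contract G).subforest _) (G := (F.subforest G').contract _)
    (Equiv.refl (Quotient G.1)) ⟨fun c d => ?_, fun c => ?_⟩
  · constructor
    · rintro ⟨⟨hne, u, v, huv, rfl, rfl⟩, hcd⟩
      exact ⟨hne, u, v, ⟨huv, (F.coveringContractEquiv_mk G ⟨G', h⟩ u v).1 hcd⟩, rfl, rfl⟩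
    · rintro ⟨hne, u, v, ⟨huv, huv'⟩, rfl, rfl⟩
      exact ⟨⟨hne, u, v, huv, rfl, rfl⟩, (F.coveringContractEquiv_mk G ⟨G', h⟩ u v).2 huv'⟩
  · rfl

open Classical in
theorem coe_contract_dec [AddCommSemigroup Ω] (F : DecForest Ω) (G : F.CoveringSubforest)
    (c : Quotient G.1) : ((F.contract G).dec c : WithZero Ω) =
      ∑ v, if Quotient.mk G.1 v = c then (F.dec v : WithZero Ω) else 0 := by
  rw [← Finset.sum_filter]
  exact coe_weightSum _ (F.block_nonempty G.1 c) _

open Classical in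
theorem cls_contract_contract [AddCommSemigroup Ω] (F : DecForest Ω) (G : F.CoveringSubforest)
    (G' : {G' : F.CoveringSubforest // G.1 ≤ G'.1}) :
    ((F.contract G).contract (F.coveringContractEquiv G G')).cls = (F.contract G'.1).cls := by
  have hmk := F.coveringContractEquiv_mk G G'
  set H := F.coveringContractEquiv G G'
  let e : Quotient H.1 ≃ Quotient G'.1.1 :=
    { toFun := Quotient.lift (Quotient.lift (Quotient.mk G'.1.1)
        fun _ _ h => Quotient.sound (G'.2 h)) fun c d h => h
      invFun := Quotient.lift (fun u => Quotient.mk H.1 (Quotient.mk G.1 u))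
        fun u v h => Quotient.sound ((hmk u v).2 h)
      left_inv := fun c => by
        obtain ⟨c, rfl⟩ := Quotient.exists_rep c
        obtain ⟨c, rfl⟩ := Quotient.exists_rep c
        rfl
      right_inv := fun c => by
        obtain ⟨c, rfl⟩ := Quotient.exists_rep c
        rfl }
  refine cls_eq (F := (F.contract G).contract H) (G := F.contract G'.1) e
    ⟨fun c d => ?_, fun c => ?_⟩
  · refine (and_congr_right fun hne => ?_).trans
      (and_congr_left fun _ => not_congr e.injective.eq_iff.symm)
    constructor
    · rintro ⟨_, _, ⟨-, u, v, huv, rfl, rfl⟩, rfl, rfl⟩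
      exact ⟨u, v, huv, rfl, rfl⟩
    · rintro ⟨u, v, huv, hu, hv⟩
      have hu' : Quotient.mk H.1 (Quotient.mk G.1 u) = c := e.injective hu
      have hv' : Quotient.mk H.1 (Quotient.mk G.1 v) = d := e.injective hv
      refine ⟨Quotient.mk G.1 u, Quotient.mk G.1 v, ⟨fun h => hne ?_, u, v, huv, rfl, rfl⟩, hu', hv'⟩
      rw [← hu', ← hv', h]
  · apply WithZero.coe_injective
    have hs : ∀ v, (Quotient.mk H.1 (Quotient.mk G.1 v) = c) ↔ Quotient.mk G'.1.1 v = e c :=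
      fun v => (e.injective.eq_iff (a := Quotient.mk H.1 (Quotient.mk G.1 v))).symm
    refine (coe_contract_dec _ H c).trans (Eq.trans ?_ (coe_contract_dec F G'.1 (e c)).symm)
    refine (Finset.sum_congr rfl fun q _ => by congr).trans
      ((sum_ite_of_fiberwise (Q := (F.contract G).V) (Quotient.mk G.1)
      (fun q => Quotient.mk H.1 q = c) _ _
      (fun q => by convert coe_contract_dec F G q; rfl)).trans ?_)
    exact Finset.sum_congr rfl fun v _ => if_congr (hs v) rfl rfl

end DecForest

theorem ArbMould.prod_assoc {k : Type*} [Field k] {A : Type*} [CommRing A] [Algebra k A]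
    {Ω : Type u} (M N P : ArbMould k A Ω) :
    ArbMould.prod (ArbMould.prod M N) P = ArbMould.prod M (ArbMould.prod N P) := by
  refine forest_hom_ext fun F => ?_
  simp only [ArbMould.prod_single, Finset.sum_mul, Finset.mul_sum]
  refine sum_comm_of_equiv (fun C D : F.AdmissibleCut => C.1 ⊆ D.1) F.cutUpperEquiv
    F.cutLowerEquiv _ _ fun C D h => ?_
  rw [F.cls_restrict_restrict C.1ᶜ _ D.1ᶜ fun v => ⟨fun hv => ⟨fun hC => hv (h hC), hv⟩,
      fun hv => hv.2⟩,
    F.cls_restrict_restrict C.1ᶜ _ (D.1 \ C.1) fun v => ⟨fun hv => ⟨hv.2, hv.1⟩,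
      fun hv => ⟨hv.2, hv.1⟩⟩,
    F.cls_restrict_restrict D.1 _ (D.1 \ C.1) fun v => ⟨fun hv => ⟨hv.1, hv.2⟩,
      fun hv => ⟨hv.1, hv.2⟩⟩,
    F.cls_restrict_restrict D.1 _ C.1 fun v => ⟨fun hv => ⟨h hv, hv⟩, fun hv => hv.2⟩, mul_assoc]

theorem ArbMould.diamond_assoc {k : Type*} [Field k] {A : Type*} [CommRing A] [Algebra k A]
    {Ω : Type u} [AddCommSemigroup Ω] (M N P : ArbMould k A Ω) :
    ArbMould.diamond (ArbMould.diamond M N) P = ArbMould.diamond M (ArbMould.diamond N P) := by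
  refine forest_hom_ext fun F => ?_
  simp only [ArbMould.diamond_single, Finset.sum_mul, Finset.mul_sum]
  refine sum_comm_of_equiv (fun G G' : F.CoveringSubforest => G.1 ≤ G'.1) F.coveringContractEquiv
    F.coveringSubforestEquiv _ _ fun G G' h => ?_
  rw [F.cls_contract_contract, F.cls_subforest_contract, F.cls_subforest_subforest, mul_assoc]

section WordEval

variable {k : Type*} [Field k] {R : Type*} [CommRing R] [Algebra k R] {Ω X Y : Type*}

/-- The quasi-symmetric evaluation of a word `w` of length `n` on a list of letters `l`: the sum
of the products `∏ⱼ χ (x j) (w j)` over the sublists `x` of `l` of length `n`. -/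
def wordEval (χ : X → Ω → R) : List X → List Ω → R
  | _, [] => 1
  | [], _ :: _ => 0
  | x :: l, a :: w => wordEval χ l (a :: w) + χ x a * wordEval χ l w

@[simp] theorem wordEval_nil (χ : X → Ω → R) (l : List X) : wordEval χ l [] = 1 := by
  cases l <;> rfl

@[simp] theorem wordEval_nil_cons (χ : X → Ω → R) (a : Ω) (w : List Ω) :
    wordEval χ [] (a :: w) = 0 := rfl

@[simp] theorem wordEval_cons_cons (χ : X → Ω → R) (x : X) (l : List X) (a : Ω) (w : List Ω) :
    wordEval χ (x :: l) (a :: w) = wordEval χ l (a :: w) + χ x a * wordEval χ l w := rfl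

theorem wordEval_map (χ : Y → Ω → R) (f : X → Y) (l : List X) (w : List Ω) :
    wordEval χ (l.map f) w = wordEval (fun x => χ (f x)) l w := by
  induction l generalizing w with
  | nil => cases w <;> simp
  | cons x l ih => cases w <;> simp [ih]

theorem map_wordEval {R' : Type*} [CommRing R'] (f : R →+* R') (χ : X → Ω → R) (l : List X)
    (w : List Ω) : f (wordEval χ l w) = wordEval (fun x a => f (χ x a)) l w := by
  induction l generalizing w with
  | nil => cases w <;> simp
  | cons x l ih => cases w <;> simp [ih]

theorem wordEval_append (χ : X → Ω → R) (l m : List X) (w : List Ω) :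
    wordEval χ (l ++ m) w =
      ∑ i ∈ Finset.range (w.length + 1), wordEval χ l (w.take i) * wordEval χ m (w.drop i) := by
  induction l generalizing w with
  | nil =>
    cases w with
    | nil => simp
    | cons a w => simp [Finset.sum_range_succ']
  | cons x l ih =>
    cases w with
    | nil => simp
    | cons a w =>
      rw [List.cons_append, wordEval_cons_cons, ih, ih, List.length_cons,
        Finset.sum_range_succ', Finset.sum_range_succ' _ (w.length + 1), Finset.mul_sum,
        add_right_comm, ← Finset.sum_add_distrib]
      simp [add_mul, mul_assoc]

/-- The linear extension of `wordEval`. -/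
noncomputable def wordEvalLin (k : Type*) [Field k] [Algebra k R] (χ : X → Ω → R) (l : List X) :
    (List Ω →₀ k) →ₗ[k] R :=
  Finsupp.linearCombination k (wordEval χ l)

@[simp] theorem wordEvalLin_single (χ : X → Ω → R) (l : List X) (w : List Ω) (c : k) :
    wordEvalLin k χ l (Finsupp.single w c) = c • wordEval χ l w := by
  simp [wordEvalLin]

theorem word_hom_ext {B : Type*} [AddCommMonoid B] [Module k B] {f g : (List Ω →₀ k) →ₗ[k] B}
    (h : ∀ w, f (Finsupp.single w 1) = g (Finsupp.single w 1)) : f = g :=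
  Finsupp.lhom_ext' fun w => LinearMap.ext_ring (h w)

theorem wordEvalLin_nil_mapDomain_cons (χ : X → Ω → R) (a : Ω) (p : List Ω →₀ k) :
    wordEvalLin k χ [] (Finsupp.mapDomain (List.cons a) p) = 0 := by
  suffices h : wordEvalLin k χ [] ∘ₗ Finsupp.lmapDomain k k (List.cons a) = 0 from
    LinearMap.congr_fun h p
  exact word_hom_ext fun w => by simp

theorem wordEvalLin_cons_mapDomain_cons (χ : X → Ω → R) (x : X) (l : List X) (a : Ω)
    (p : List Ω →₀ k) :
    wordEvalLin k χ (x :: l) (Finsupp.mapDomain (List.cons a) p) =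
      wordEvalLin k χ l (Finsupp.mapDomain (List.cons a) p) + χ x a * wordEvalLin k χ l p := by
  suffices h : wordEvalLin k χ (x :: l) ∘ₗ Finsupp.lmapDomain k k (List.cons a) =
      wordEvalLin k χ l ∘ₗ Finsupp.lmapDomain k k (List.cons a) +
        LinearMap.mulLeft k (χ x a) ∘ₗ wordEvalLin k χ l from LinearMap.congr_fun h p
  exact word_hom_ext fun w => by simp

theorem wordEvalLin_qsh [Add Ω] (χ : X → Ω → R) (hχ : ∀ x a b, χ x (a + b) = χ x a * χ x b)
    (l : List X) (v w : List Ω) :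
    wordEvalLin k χ l (qsh k v w) = wordEval χ l v * wordEval χ l w := by
  induction l generalizing v w with
  | nil =>
    cases v with
    | nil => simp [qsh]
    | cons a v =>
      cases w with
      | nil => simp [qsh]
      | cons b w => simp [qsh, wordEvalLin_nil_mapDomain_cons]
  | cons x l ih =>
    cases v with
    | nil => simp [qsh]
    | cons a v =>
      cases w with
      | nil => simp [qsh]
      | cons b w =>
        have h := ih (a :: v) (b :: w)
        rw [qsh, map_add, map_add] at h ⊢
        rw [wordEvalLin_cons_mapDomain_cons, wordEvalLin_cons_mapDomain_cons,
          wordEvalLin_cons_mapDomain_cons, ih, ih, ih, wordEval_cons_cons, wordEval_cons_cons, hχ]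
        linear_combination h

theorem wordEvalLin_qshMul [Add Ω] (χ : X → Ω → R)
    (hχ : ∀ x a b, χ x (a + b) = χ x a * χ x b) (l : List X) (p q : List Ω →₀ k) :
    wordEvalLin k χ l (qshMul k p q) = wordEvalLin k χ l p * wordEvalLin k χ l q := by
  suffices h : (qshMul k).compr₂ (wordEvalLin k χ l) =
      (LinearMap.mul k R).compl₁₂ (wordEvalLin k χ l) (wordEvalLin k χ l) from
    LinearMap.congr_fun₂ h p q
  refine word_hom_ext fun v => word_hom_ext fun w => ?_
  simp [qshMul, wordEvalLin_qsh χ hχ]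

theorem wordEvalLin_qshList [Add Ω] (χ : X → Ω → R)
    (hχ : ∀ x a b, χ x (a + b) = χ x a * χ x b) (l : List X) (L : List (List Ω)) :
    wordEvalLin k χ l (qshList k L) = (L.map (wordEval χ l)).prod := by
  induction L with
  | nil => simp [qshList]
  | cons v L ih => simp [qshList, wordEvalLin_qshMul χ hχ, ih]

theorem wordEval_map_pair (χ : X → Ω → R) (ψ : Y → Ω → R) (x : X) (m : List Y) (w : List Ω) :
    wordEval (fun p : X × Y => fun a => χ p.1 a * ψ p.2 a) (m.map (Prod.mk x)) w =
      (w.map (χ x)).prod * wordEval ψ m w := by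
  rw [wordEval_map]
  induction m generalizing w with
  | nil => cases w <;> simp
  | cons y m ih =>
    cases w with
    | nil => simp
    | cons a w =>
      rw [wordEval_cons_cons, wordEval_cons_cons, ih, ih]
      simp only [List.map_cons, List.prod_cons]
      ring

theorem prod_map_of_wordWeight [AddSemigroup Ω] (χ : Ω → R)
    (hχ : ∀ a b, χ (a + b) = χ a * χ b) (a : Ω) (w : List Ω) :
    χ (w.foldl (· + ·) a) = ((a :: w).map χ).prod := by
  induction w generalizing a with
  | nil => simp
  | cons b w ih => simp [ih, hχ, mul_assoc]

end WordEval

section Decompositions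

variable {α B : Type*} [AddCommMonoid B]

theorem mem_range_splitWrtComposition (w : List α) (L : List (List α)) :
    (∃ c : Composition w.length, w.splitWrtComposition c = L) ↔ L.flatten = w ∧ [] ∉ L := by
  constructor
  · rintro ⟨c, rfl⟩
    refine ⟨w.flatten_splitWrtComposition c, fun h => ?_⟩
    simpa using List.length_pos_of_mem_splitWrtComposition h
  · rintro ⟨rfl, hL⟩
    refine ⟨⟨L.map List.length, fun {i} hi => ?_, List.length_flatten.symm⟩,
      List.splitWrtComposition_flatten L _ rfl⟩
    obtain ⟨v, hv, rfl⟩ := List.mem_map.1 hi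
    exact List.length_pos_iff.2 fun h => hL (h ▸ hv)

theorem splitWrtComposition_injective (w : List α) :
    Function.Injective fun c : Composition w.length => w.splitWrtComposition c := by
  intro c d h
  have h' := congrArg (List.map List.length) h
  simp only [List.map_length_splitWrtComposition] at h'
  exact Composition.ext h'

open Classical in
/-- The decompositions of a word into nonempty words. -/
noncomputable def decompositions (w : List α) : Finset (List (List α)) :=
  Finset.univ.image fun c : Composition w.length => w.splitWrtComposition c

theorem mem_decompositions {w : List α} {L : List (List α)} :
    L ∈ decompositions w ↔ L.flatten = w ∧ [] ∉ L := by
  rw [← mem_range_splitWrtComposition]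
  simp [decompositions]

open Classical in
theorem sum_composition (f : List (List α) → B) (w : List α) :
    ∑ c : Composition w.length, f (w.splitWrtComposition c) = ∑ L ∈ decompositions w, f L :=
  (Finset.sum_image (g := fun c : Composition w.length => w.splitWrtComposition c)
    fun _ _ _ _ h => splitWrtComposition_injective w h).symm

theorem decompositions_nil : decompositions ([] : List α) = {[]} := by
  ext L
  rw [mem_decompositions, Finset.mem_singleton]
  constructor
  · rintro ⟨h, hL⟩
    cases L with
    | nil => rfl
    | cons v L => exact (hL (by simp_all)).elim
  · rintro rfl
    simp

/-- A decomposition of a nonempty word consists of a nonempty prefix and of a decomposition of the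
remaining suffix. -/
theorem sum_decompositions_cons (f : List (List α) → B) (a : α) (w : List α) :
    ∑ L ∈ decompositions (a :: w), f L =
      ∑ i ∈ Finset.range (w.length + 1), ∑ L ∈ decompositions (w.drop i),
        f ((a :: w.take i) :: L) := by
  rw [Finset.sum_sigma']
  symm
  refine Finset.sum_bij (fun x _ => (a :: w.take x.1) :: x.2) ?_ ?_ ?_ fun _ _ => rfl
  · rintro ⟨i, L⟩ h
    simp only [Finset.mem_sigma, mem_decompositions, Finset.mem_range] at h ⊢
    simp [h.2]
  · rintro ⟨i, L⟩ h ⟨j, L'⟩ h' heq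
    simp only [Finset.mem_sigma, Finset.mem_range] at h h'
    simp only [List.cons.injEq, true_and] at heq
    obtain ⟨h1, rfl⟩ := heq
    have h2 := congrArg List.length h1
    simp only [List.length_take] at h2
    obtain rfl : i = j := by omega
    rfl
  · intro L hL
    rw [mem_decompositions] at hL
    obtain ⟨h, hL⟩ := hL
    cases L with
    | nil => simp at h
    | cons v L =>
      cases v with
      | nil => simp at hL
      | cons b v =>
        simp only [List.flatten_cons, List.cons_append, List.cons.injEq] at h
        obtain ⟨rfl, rfl⟩ := h
        refine ⟨⟨v.length, L⟩, ?_, by simp⟩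
        simp_all [mem_decompositions]

end Decompositions

section WordGamma
variable {k : Type*} [Field k] {R : Type*} [CommRing R] [Algebra k R] {Ω X Y : Type*}

/-- The evaluation of the internal coproduct of a word. -/
theorem wordEval_product [AddSemigroup Ω] (χ : X → Ω → R) (ψ : Y → Ω → R)
    (hχ : ∀ x a b, χ x (a + b) = χ x a * χ x b) (l : List X) (m : List Y) (w : List Ω) :
    ∑ L ∈ decompositions w,
      wordEval χ l (L.filterMap wordWeight) * (L.map (wordEval ψ m)).prod =
    wordEval (fun p : X × Y => fun a => χ p.1 a * ψ p.2 a) (l ×ˢ m) w := by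
  induction l generalizing w with
  | nil =>
    cases w with
    | nil => simp [decompositions_nil]
    | cons a w => simp [sum_decompositions_cons, wordWeight]
  | cons x l ih =>
    cases w with
    | nil => simp [decompositions_nil]
    | cons a w =>
      have h := ih (a :: w)
      rw [sum_decompositions_cons] at h
      rw [List.product_cons, wordEval_append, List.length_cons, Finset.sum_range_succ',
        sum_decompositions_cons]
      simp only [List.take_zero, List.drop_zero, wordEval_nil, one_mul, ← h, List.take_succ_cons,
        List.drop_succ_cons, wordEval_map_pair, ← ih]
      simp only [List.filterMap_cons, wordWeight, List.map_cons, List.prod_cons,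
        wordEval_cons_cons, prod_map_of_wordWeight _ (hχ x), add_mul, Finset.sum_add_distrib,
        Finset.mul_sum]
      rw [add_comm]
      congr 1
      refine Finset.sum_congr rfl fun i _ => Finset.sum_congr rfl fun c _ => ?_
      ring

/-- The evaluation of tensors of words. -/
noncomputable def wordEvalTensor (k : Type*) [Field k] [Algebra k R] (χ : X → Ω → R) (l : List X)
    (ψ : Y → Ω → R) (m : List Y) : (List Ω →₀ k) ⊗[k] (List Ω →₀ k) →ₗ[k] R :=
  LinearMap.mul' k R ∘ₗ TensorProduct.map (wordEvalLin k χ l) (wordEvalLin k ψ m)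

@[simp] theorem wordEvalTensor_tmul (χ : X → Ω → R) (l : List X) (ψ : Y → Ω → R) (m : List Y)
    (p q : List Ω →₀ k) : wordEvalTensor k χ l ψ m (p ⊗ₜ q) =
      wordEvalLin k χ l p * wordEvalLin k ψ m q := by
  simp [wordEvalTensor]

theorem wordEvalTensor_wordDelta (χ : X → Ω → R) (ψ : Y → Ω → R) (l : List X) (m : List Y)
    (p : List Ω →₀ k) : wordEvalTensor k χ l ψ m (wordDelta k p) =
      wordEvalLin k (Sum.elim χ ψ) (l.map Sum.inl ++ m.map Sum.inr) p := by
  suffices h : wordEvalTensor k χ l ψ m ∘ₗ wordDelta k =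
      wordEvalLin k (Sum.elim χ ψ) (l.map Sum.inl ++ m.map Sum.inr) from LinearMap.congr_fun h p
  refine word_hom_ext fun w => ?_
  simp [wordDelta, wordEval_append, wordEval_map]

theorem wordEvalTensor_wordGamma [AddSemigroup Ω] (χ : X → Ω → R) (ψ : Y → Ω → R)
    (hχ : ∀ x a b, χ x (a + b) = χ x a * χ x b) (hψ : ∀ x a b, ψ x (a + b) = ψ x a * ψ x b)
    (l : List X) (m : List Y) (p : List Ω →₀ k) :
    wordEvalTensor k χ l ψ m (wordGamma k p) =
      wordEvalLin k (fun p : X × Y => fun a => χ p.1 a * ψ p.2 a) (l ×ˢ m) p := by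
  suffices h : wordEvalTensor k χ l ψ m ∘ₗ wordGamma k =
      wordEvalLin k (fun p : X × Y => fun a => χ p.1 a * ψ p.2 a) (l ×ˢ m) from
    LinearMap.congr_fun h p
  refine word_hom_ext fun w => ?_
  simp only [LinearMap.comp_apply, wordGamma, Finsupp.linearCombination_single, one_smul, map_sum,
    wordEvalTensor_tmul, wordEvalLin_single, wordEvalLin_qshList ψ hψ]
  rw [sum_composition (fun L => wordEval χ l (L.filterMap wordWeight) *
    (L.map (wordEval ψ m)).prod), wordEval_product χ ψ hχ]

end WordGamma

@[to_additive]
theorem prod_univ_congr {α R : Type*} [CommMonoid R] {i j : Fintype α} {f g : α → R}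
    (h : ∀ a, f a = g a) :
    ∏ a ∈ @Finset.univ α i, f a = ∏ a ∈ @Finset.univ α j, g a := by
  obtain rfl : i = j := Subsingleton.elim i j
  exact Finset.prod_congr rfl fun a _ => h a

theorem char_weightSum {Ω ι R : Type*} [AddCommSemigroup Ω] [CommRing R] (χ : Ω → R)
    (hχ : ∀ a b, χ (a + b) = χ a * χ b) (s : Finset ι) (hs : s.Nonempty) (d : ι → Ω) :
    χ (weightSum s hs d) = ∏ i ∈ s, χ (d i) := by
  induction hs using Finset.Nonempty.cons_induction with
  | singleton i =>
    rw [Finset.prod_singleton]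
    refine congrArg χ (WithZero.coe_injective ?_)
    rw [coe_weightSum, Finset.sum_singleton]
  | cons i s hi hs ih =>
    rw [Finset.prod_cons, ← ih, ← hχ]
    refine congrArg χ (WithZero.coe_injective ?_)
    rw [coe_weightSum, Finset.sum_cons, WithZero.coe_add, coe_weightSum]

open Classical in
/-- The evaluation of a word on a sorted list, as a sum over strictly increasing maps. -/
theorem wordEval_ofFn {R Ω X : Type*} [CommRing R] [LinearOrder X] [Fintype X] (χ : X → Ω → R)
    (l : List X) (hl : l.Pairwise (· < ·)) {s : ℕ} (g : Fin s → Ω) :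
    wordEval χ l (List.ofFn g) =
      ∑ φ : Fin s → X with StrictMono φ ∧ ∀ i, φ i ∈ l, ∏ i, χ (φ i) (g i) := by
  have hzero : ∀ (l : List X) (g : Fin 0 → Ω), wordEval χ l (List.ofFn g) =
      ∑ φ : Fin 0 → X with StrictMono φ ∧ ∀ i, φ i ∈ l, ∏ i, χ (φ i) (g i) := fun l g => by
    rw [Finset.filter_true_of_mem fun φ _ => ⟨fun i => i.elim0, fun i => i.elim0⟩]
    simp
  induction l generalizing s with
  | nil =>
    cases s with
    | zero => exact hzero _ _
    | succ s =>
      rw [Finset.filter_false_of_mem fun φ _ h => by simpa using h.2 0]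
      simp
  | cons x l ih =>
    cases s with
    | zero => exact hzero _ _
    | succ s =>
      obtain ⟨hx, hl⟩ := List.pairwise_cons.1 hl
      rw [List.ofFn_succ, wordEval_cons_cons, ← List.ofFn_succ, ih hl, ih hl,
        ← Finset.sum_filter_add_sum_filter_not (Finset.univ.filter
          fun φ : Fin (s + 1) → X => StrictMono φ ∧ ∀ i, φ i ∈ x :: l) (fun φ => φ 0 = x),
        Finset.mul_sum, Finset.filter_filter, Finset.filter_filter]
      refine (add_comm _ _).trans (congrArg₂ (· + ·) ?_ ?_)
      · refine Finset.sum_bij (fun φ _ => (Fin.cons x φ : Fin (s + 1) → X)) ?_ ?_ ?_ ?_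
        · intro φ hφ
          simp only [Finset.mem_filter, Finset.mem_univ, true_and] at hφ ⊢
          refine ⟨⟨fun i j hij => ?_, ?_⟩, rfl⟩
          · obtain ⟨j, rfl⟩ := Fin.exists_succ_eq.2 (Fin.ne_zero_of_lt hij)
            rw [Fin.cons_succ]
            induction i using Fin.cases with
            | zero => exact hx _ (hφ.2 j)
            | succ i => exact hφ.1 (Fin.succ_lt_succ_iff.1 hij)
          · refine Fin.cases (by simp) fun i => ?_
            simp [hφ.2 i]
        · intro φ _ φ' _ h
          exact Fin.cons_right_injective (α := fun _ => X) x h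
        · intro φ hφ
          simp only [Finset.mem_filter, Finset.mem_univ, true_and] at hφ
          obtain ⟨⟨hm, hmem⟩, h0⟩ := hφ
          refine ⟨Fin.tail φ, ?_, ?_⟩
          · simp only [Finset.mem_filter, Finset.mem_univ, true_and]
            refine ⟨fun i j hij => hm (Fin.succ_lt_succ_iff.2 hij), fun i => ?_⟩
            have h := hm (Fin.succ_pos i)
            rw [h0] at h
            exact (List.mem_cons.1 (hmem i.succ)).resolve_left h.ne'
          · rw [← h0]
            exact Fin.cons_self_tail φ
        · intro φ _
          simp [Fin.prod_univ_succ]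
      · refine Finset.sum_congr (Finset.filter_congr fun φ _ => ?_) fun _ _ => rfl
        constructor
        · rintro ⟨hm, hmem⟩
          exact ⟨⟨hm, fun i => List.mem_cons_of_mem _ (hmem i)⟩, fun h =>
            (hx _ (hmem 0)).ne' h⟩
        · rintro ⟨⟨hm, hmem⟩, h0⟩
          refine ⟨hm, fun i => (List.mem_cons.1 (hmem i)).resolve_left fun hi => ?_⟩
          have h1 := hx _ ((List.mem_cons.1 (hmem 0)).resolve_left h0)
          have h2 := hm.monotone (Fin.zero_le i)
          rw [hi] at h2
          exact absurd h1 (not_lt.2 h2)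

namespace DecForest

variable {Ω : Type u} {R X Y : Type*} [CommRing R]

/-- A map from the vertices of a forest to an ordered set is strict if it decreases along the
edges. -/
def IsStrict [LT X] (F : DecForest Ω) (σ : F.V → X) : Prop := ∀ u v, F.edge u v → σ v < σ u

theorem isStrict_iff_lt [Preorder X] (F : DecForest Ω) (σ : F.V → X) :
    F.IsStrict σ ↔ ∀ u v, F.lt u v → σ v < σ u := by
  refine ⟨fun h u v huv => ?_, fun h u v huv => h u v (.single huv)⟩
  induction huv with
  | single h' => exact h _ _ h'
  | tail _ h' ih => exact (h _ _ h').trans ih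

open Classical in
/-- The evaluation of a forest on an ordered set of letters: the sum of the products of the
evaluations of the decorations over all strict maps. -/
noncomputable def eval [Fintype X] [LT X] (F : DecForest Ω) (χ : X → Ω → R) : R :=
  ∑ σ : F.V → X with F.IsStrict σ, ∏ v, χ (σ v) (F.dec v)

theorem wordEvalLin_arborification {k : Type*} [Field k] [Algebra k R] [AddCommSemigroup Ω]
    [LinearOrder X] [Fintype X] (F : DecForest Ω) (χ : X → Ω → R)
    (hχ : ∀ x a b, χ x (a + b) = χ x a * χ x b) (l : List X) (hl : l.Pairwise (· < ·))
    (hmem : ∀ x, x ∈ l) :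
    wordEvalLin k χ l (arborification k (Finsupp.single F.cls 1)) = F.eval χ := by
  classical
  have hprod : ∀ s (τ : F.LinExt s), wordEval χ l (F.extWord τ) =
      ∑ φ : Fin s → X with StrictMono φ, ∏ v, χ (φ (τ.1 v)) (F.dec v) := by
    intro s τ
    rw [extWord, wordEval_ofFn χ l hl]
    refine Finset.sum_congr (by simp [hmem]) fun φ _ => ?_
    rw [← Finset.prod_fiberwise _ τ.1]
    refine Finset.prod_congr rfl fun i _ => ?_
    rw [char_weightSum _ (hχ _)]
    refine Finset.prod_congr (by ext; simp) fun v hv => ?_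
    rw [(Finset.mem_filter.1 hv).2]
  rw [arborification_single]
  simp only [map_sum, wordEvalLin_single, one_smul, hprod]
  rw [Finset.sum_sigma', Finset.sum_sigma', eval]
  have hcard : ∀ {s : ℕ} (τ : F.LinExt s) (φ : Fin s → X), StrictMono φ →
      (Finset.univ.image (φ ∘ τ.1)).card = s := fun {s} τ φ hφ => by
    rw [← Finset.image_image, Finset.image_univ_of_surjective τ.2.1,
      Finset.card_image_of_injective _ hφ.injective, Finset.card_fin]
  refine Finset.sum_bij (fun x _ => x.2 ∘ x.1.2.1) ?_ ?_ ?_ fun _ _ => rfl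
  · rintro ⟨⟨s, τ⟩, φ⟩ h
    simp only [Finset.mem_sigma, Finset.mem_filter, Finset.mem_univ, true_and] at h ⊢
    exact (F.isStrict_iff_lt _).2 fun u v huv => h.2 (τ.2.2 u v huv)
  · rintro ⟨⟨s, τ⟩, φ⟩ h ⟨⟨s', τ'⟩, φ'⟩ h' heq
    simp only [Finset.mem_sigma, Finset.mem_filter, Finset.mem_univ, true_and] at h h' heq
    obtain rfl : s = s' := by
      rw [← hcard τ φ h.2, ← hcard τ' φ' h'.2, heq]
    have hφ : φ = φ' := by
      rw [Finset.orderEmbOfFin_unique (hcard τ φ h.2) (f := φ) ?_ h.2,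
        Finset.orderEmbOfFin_unique (hcard τ φ h.2) (f := φ') ?_ h'.2]
      · intro i
        obtain ⟨v, rfl⟩ := τ'.2.1 i
        rw [heq]
        exact Finset.mem_image_of_mem _ (Finset.mem_univ v)
      · intro i
        obtain ⟨v, rfl⟩ := τ.2.1 i
        exact Finset.mem_image_of_mem _ (Finset.mem_univ v)
    subst hφ
    have hτ : τ = τ' := Subtype.ext (funext fun v => h.2.injective (congrFun heq v))
    rw [hτ]
  · intro σ hσ
    have hσ' := (F.isStrict_iff_lt _).1 (Finset.mem_filter.1 hσ).2
    set t := Finset.univ.image σ with ht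
    let e := t.orderIsoOfFin rfl
    have hmemt : ∀ v, σ v ∈ t := fun v => Finset.mem_image_of_mem _ (Finset.mem_univ v)
    refine ⟨⟨⟨t.card, fun v => e.symm ⟨σ v, hmemt v⟩, ?_, fun u v huv => ?_⟩,
      fun i => (e i).1⟩, ?_, ?_⟩
    · intro i
      obtain ⟨v, -, hv⟩ := Finset.mem_image.1 (e i).2
      refine ⟨v, ?_⟩
      rw [OrderIso.symm_apply_eq]
      exact Subtype.ext hv
    · exact e.symm.strictMono (hσ' u v huv)
    · simp only [Finset.mem_sigma, Finset.mem_filter, Finset.mem_univ, true_and, Finset.mem_range,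
        and_true]
      refine ⟨Nat.lt_succ_of_le (Finset.card_image_le.trans ?_), e.strictMono⟩
      rw [Finset.card_univ, Nat.card_eq_fintype_card]
    · funext v
      simp

theorem eval_union [Fintype X] [LT X] (F G : DecForest Ω) (χ : X → Ω → R) :
    (F.union G).eval χ = F.eval χ * G.eval χ := by
  classical
  have hstrict : ∀ σ : F.V ⊕ G.V → X, (F.union G).IsStrict σ ↔
      F.IsStrict (σ ∘ Sum.inl) ∧ G.IsStrict (σ ∘ Sum.inr) := by
    intro σ
    constructor
    · intro h
      exact ⟨fun u v huv => h _ _ (Sum.LiftRel.inl huv), fun u v huv => h _ _ (Sum.LiftRel.inr huv)⟩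
    · rintro ⟨h, h'⟩ _ _ (huv | huv)
      · exact h _ _ huv
      · exact h' _ _ huv
  unfold eval
  rw [Finset.sum_mul_sum, ← Finset.sum_product']
  refine Finset.sum_equiv (Equiv.sumArrowEquivProdArrow F.V G.V X) (fun σ => ?_) fun σ _ => ?_
  · rw [Finset.mem_filter, Finset.mem_product, Finset.mem_filter, Finset.mem_filter]
    simp only [Finset.mem_univ, true_and]
    exact hstrict σ
  · refine Eq.trans ?_ (Fintype.prod_sum_type fun v => χ (σ v) ((F.union G).dec v))
    exact prod_univ_congr fun _ => rfl

theorem eval_sumLex [Fintype X] [Fintype Y] [LT X] [LT Y] (F : DecForest Ω) (χ : X → Ω → R)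
    (ψ : Y → Ω → R) :
    F.eval (fun z : X ⊕ₗ Y => Sum.elim χ ψ (ofLex z)) =
      ∑ C : F.AdmissibleCut, (F.restrict C.1ᶜ).eval χ * (F.restrict C.1).eval ψ := by
  classical
  unfold eval
  simp only [Finset.sum_mul_sum, ← Finset.sum_product']
  rw [Finset.sum_sigma']
  symm
  refine Finset.sum_bij (fun x _ => fun v => if h : v ∈ x.1.1 then toLex (Sum.inr (x.2.2 ⟨v, h⟩))
    else toLex (Sum.inl (x.2.1 ⟨v, h⟩))) ?_ ?_ ?_ ?_
  · rintro ⟨C, α, β⟩ h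
    simp only [Finset.mem_sigma, Finset.mem_filter, Finset.mem_univ, true_and,
      Finset.mem_product] at h ⊢
    intro u v huv
    by_cases hv : v ∈ C.1
    · have hu := C.mem_of_edge huv hv
      simp only [hv, hu, dif_pos, Sum.Lex.inr_lt_inr_iff]
      exact h.2 ⟨u, hu⟩ ⟨v, hv⟩ huv
    · by_cases hu : u ∈ C.1
      · simp only [hv, hu, dif_pos, dif_neg, not_false_eq_true, Sum.Lex.inl_lt_inr]
      · simp only [hv, hu, dif_neg, not_false_eq_true, Sum.Lex.inl_lt_inl_iff]
        exact h.1 ⟨u, hu⟩ ⟨v, hv⟩ huv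
  · rintro ⟨C, α, β⟩ h ⟨C', α', β'⟩ h' heq
    have heq := congrFun heq
    dsimp only at heq
    obtain rfl : C = C' := by
      refine Subtype.ext (Set.ext fun v => ?_)
      have := heq v
      split_ifs at this with h1 h2 h2
      · exact iff_of_true h1 h2
      · simp at this
      · simp at this
      · exact iff_of_false h1 h2
    obtain rfl : α = α' := by
      funext v
      have h1 := heq v.1
      have h2 : v.1 ∉ C.1 := v.2
      rw [dif_neg h2, dif_neg h2] at h1
      exact Sum.inl_injective (toLex.injective h1)
    obtain rfl : β = β' := by
      funext v
      have h1 := heq v.1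
      have h2 : v.1 ∈ C.1 := v.2
      rw [dif_pos h2, dif_pos h2] at h1
      exact Sum.inr_injective (toLex.injective h1)
    rfl
  · intro σ hσ
    have hσ := (Finset.mem_filter.1 hσ).2
    let S : Set F.V := {v | ∃ y, σ v = toLex (Sum.inr y)}
    have hS : ∀ v : (Sᶜ : Set F.V), ∃ x, σ v = toLex (Sum.inl x) := fun v => by
      rcases h : ofLex (σ v) with x | y
      · exact ⟨x, h⟩
      · exact (v.2 ⟨y, h⟩).elim
    choose β hβ using fun v : S => v.2
    choose α hα using hS
    refine ⟨⟨⟨S, (F.admissible_iff S).2 fun x y hyx hx => ?_⟩, α, β⟩, ?_, ?_⟩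
    · by_contra hy
      have h := hσ y x hyx
      rw [hα ⟨y, hy⟩, hβ ⟨x, hx⟩] at h
      exact Sum.Lex.not_inr_lt_inl h
    · refine Finset.mem_sigma.2 ⟨Finset.mem_univ _, Finset.mem_product.2
        ⟨Finset.mem_filter.2 ⟨Finset.mem_univ _, ?_⟩, Finset.mem_filter.2 ⟨Finset.mem_univ _, ?_⟩⟩⟩
      · intro u v huv
        have h := hσ _ _ huv
        rwa [hα u, hα v, Sum.Lex.inl_lt_inl_iff] at h
      · intro u v huv
        have h := hσ _ _ huv
        rwa [hβ u, hβ v, Sum.Lex.inr_lt_inr_iff] at h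
    · funext v
      by_cases hv : v ∈ S
      · simpa [hv] using (hβ ⟨v, hv⟩).symm
      · simpa [hv] using (hα ⟨v, hv⟩).symm
  · rintro ⟨C, α, β⟩ h
    rw [← Fintype.prod_subtype_mul_prod_subtype (fun v => v ∈ C.1), mul_comm]
    congr 1
    · refine prod_univ_congr fun v => ?_
      have hv : v.1 ∈ C.1 := v.2
      simp only [dif_pos hv]
      rfl
    · refine prod_univ_congr fun v => ?_
      have hv : v.1 ∉ C.1 := v.2
      simp only [dif_neg hv]
      rfl

open Classical in
theorem char_contract_dec [AddCommSemigroup Ω] (F : DecForest Ω) (χ : Ω → R)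
    (hχ : ∀ a b, χ (a + b) = χ a * χ b) (G : F.CoveringSubforest) (c : Quotient G.1) :
    χ ((F.contract G).dec c) = ∏ v with Quotient.mk G.1 v = c, χ (F.dec v) :=
  char_weightSum χ hχ _ (F.block_nonempty G.1 c) _

open Classical in
theorem eval_contract [AddCommSemigroup Ω] [Fintype X] [LT X] (F : DecForest Ω) (χ : X → Ω → R)
    (hχ : ∀ x a b, χ x (a + b) = χ x a * χ x b) (G : F.CoveringSubforest) :
    (F.contract G).eval χ = ∑ α : F.V → X with (∀ u v, G.1 u v → α u = α v) ∧
      ∀ u v, F.edge u v → ¬ G.1 u v → α v < α u, ∏ v, χ (α v) (F.dec v) := by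
  unfold eval
  refine Finset.sum_bij (fun α _ => α ∘ Quotient.mk G.1) ?_ ?_ ?_ ?_
  · intro α hα
    simp only [Finset.mem_filter, Finset.mem_univ, true_and] at hα ⊢
    exact ⟨fun u v h => congrArg α (Quotient.sound h), fun u v huv h =>
      hα _ _ ⟨fun h' => h (Quotient.exact h'), u, v, huv, rfl, rfl⟩⟩
  · intro α _ α' _ h
    funext c
    obtain ⟨v, rfl⟩ := Quotient.exists_rep c
    exact congrFun h v
  · intro α hα
    simp only [Finset.mem_filter, Finset.mem_univ, true_and] at hα
    refine ⟨Quotient.lift α hα.1, ?_, rfl⟩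
    refine Finset.mem_filter.2 ⟨Finset.mem_univ _, ?_⟩
    rintro _ _ ⟨hne, u, v, huv, rfl, rfl⟩
    exact hα.2 u v huv fun h => hne (Quotient.sound h)
  · intro α _
    refine Eq.trans ?_ (Finset.prod_fiberwise Finset.univ (Quotient.mk G.1) _)
    refine prod_univ_congr fun c => ?_
    have hc := char_contract_dec F (χ (α c)) (hχ _) G c
    refine hc.trans (Finset.prod_congr ?_ fun v hv => ?_)
    · ext v
      simp only [Finset.mem_filter]
    have hv' : Quotient.mk G.1 v = c := by simpa only [Finset.mem_filter, Finset.mem_univ, true_and] using hv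
    rw [← hv']
    rfl

theorem eval_prodLex [AddCommSemigroup Ω] [Fintype X] [Fintype Y] [PartialOrder X] [PartialOrder Y]
    (F : DecForest Ω) (χ : X → Ω → R) (hχ : ∀ x a b, χ x (a + b) = χ x a * χ x b)
    (ψ : Y → Ω → R) :
    F.eval (fun z : X ×ₗ Y => fun a => χ (ofLex z).1 a * ψ (ofLex z).2 a) =
      ∑ G : F.CoveringSubforest, (F.contract G).eval χ * (F.subforest G).eval ψ := by
  classical
  let r : (F.V → X) → Setoid F.V := fun α => Relation.EqvGen.setoid fun u v => F.edge u v ∧ α u = α v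
  have hr : ∀ α u v, r α u v → α u = α v := fun α u v h =>
    rel_of_eqvGen (Setoid.ker α) (fun _ _ h => h.2) h
  let comp : (F.V → X) → F.CoveringSubforest := fun α => ⟨r α, fun u v h =>
    eqvGen_imp (fun a b hab => ⟨hab.1, .rel _ _ hab⟩) h⟩
  have huniq : ∀ α (G : F.CoveringSubforest), (∀ u v, G.1 u v → α u = α v) →
      (∀ u v, F.edge u v → ¬ G.1 u v → α v < α u) → G = comp α := by
    intro α G h h'
    refine Subtype.ext (Setoid.ext fun u v => ⟨fun huv => ?_, fun huv => ?_⟩)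
    · exact eqvGen_imp (fun a b hab => ⟨hab.1, h _ _ hab.2⟩) (G.2 u v huv)
    · refine rel_of_eqvGen G.1 (fun a b hab => by_contra fun hG => ?_) huv
      exact (h' a b hab.1 hG).ne hab.2.symm
  simp only [eval_contract F χ hχ]
  unfold eval
  simp only [Finset.sum_mul_sum, ← Finset.sum_product']
  rw [Finset.sum_sigma']
  symm
  refine Finset.sum_bij (fun x _ => fun v => toLex (x.2.1 v, x.2.2 v)) ?_ ?_ ?_ ?_
  · rintro ⟨G, α, β⟩ h
    simp only [Finset.mem_sigma, Finset.mem_filter, Finset.mem_univ, true_and,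
      Finset.mem_product] at h ⊢
    intro u v huv
    rw [Prod.Lex.lt_iff]
    by_cases hG : G.1 u v
    · exact .inr ⟨(h.1.1 u v hG).symm, h.2 u v ⟨huv, hG⟩⟩
    · exact .inl (h.1.2 u v huv hG)
  · rintro ⟨G, α, β⟩ h ⟨G', α', β'⟩ h' heq
    simp only [Finset.mem_sigma, Finset.mem_filter, Finset.mem_univ, true_and,
      Finset.mem_product] at h h'
    obtain rfl : α = α' := funext fun v => congrArg Prod.fst (congrFun heq v)
    obtain rfl : β = β' := funext fun v => congrArg Prod.snd (congrFun heq v)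
    obtain rfl : G = G' := (huniq α G h.1.1 h.1.2).trans (huniq α G' h'.1.1 h'.1.2).symm
    rfl
  · intro σ hσ
    have hσ := (Finset.mem_filter.1 hσ).2
    refine ⟨⟨comp fun v => (ofLex (σ v)).1, fun v => (ofLex (σ v)).1, fun v => (ofLex (σ v)).2⟩,
      ?_, rfl⟩
    simp only [Finset.mem_sigma, Finset.mem_filter, Finset.mem_univ, true_and,
      Finset.mem_product]
    refine ⟨⟨hr _, fun u v huv hG => ?_⟩, fun u v huv => ?_⟩
    · refine (Prod.Lex.lt_iff.1 (hσ u v huv)).resolve_right fun h => hG ?_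
      exact .rel _ _ ⟨huv, h.1.symm⟩
    · refine ((Prod.Lex.lt_iff.1 (hσ u v huv.1)).resolve_left fun h => ?_).2
      exact h.ne (hr _ _ _ huv.2).symm
  · rintro ⟨G, α, β⟩ h
    exact Finset.prod_mul_distrib.symm

end DecForest

section Separation

variable {k : Type v} [Field k] {Ω : Type u}

open Classical in
/-- The coefficient of a word can be recovered from the evaluations of the words. -/
theorem exists_dual_wordEval (k : Type v) [Field k] [AddCommSemigroup Ω] (u : List Ω) :
    ∃ (R : Type (max v u)) (_ : CommRing R) (_ : Algebra k R) (χ : Fin u.length → Ω → R),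
      (∀ x a b, χ x (a + b) = χ x a * χ x b) ∧ ∃ D : R →ₗ[k] k, ∀ w,
        D (wordEval χ (List.finRange u.length) w) = if w = u then 1 else 0 := by
  induction u with
  | nil =>
    refine ⟨ULift.{u} k, inferInstance, inferInstance, fun i => i.elim0, fun i => i.elim0,
      ULift.moduleEquiv.toLinearMap, fun w => ?_⟩
    cases w <;> simp
  | cons b u ih =>
    obtain ⟨R, _, _, χ, hχ, D, hD⟩ := ih
    let χ' : Fin (u.length + 1) → Ω → AddMonoidAlgebra R (WithZero Ω) :=
      Fin.cons (fun a => AddMonoidAlgebra.single (a : WithZero Ω) 1)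
        fun i a => AddMonoidAlgebra.singleZeroRingHom (χ i a)
    let c : AddMonoidAlgebra R (WithZero Ω) →ₗ[k] R :=
      { toFun := fun r => r.coeff (b : WithZero Ω)
        map_add' := fun _ _ => rfl
        map_smul' := fun _ _ => rfl }
    have hsucc : ∀ w, wordEval χ' ((List.finRange u.length).map Fin.succ) w =
        AddMonoidAlgebra.single 0 (wordEval χ (List.finRange u.length) w) := fun w => by
      rw [wordEval_map]
      exact (map_wordEval (AddMonoidAlgebra.singleZeroRingHom :
        R →+* AddMonoidAlgebra R (WithZero Ω)) χ _ w).symm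
    refine ⟨AddMonoidAlgebra R (WithZero Ω), inferInstance, inferInstance, χ', ?_, D ∘ₗ c, ?_⟩
    · refine Fin.cases (fun a a' => ?_) fun i a a' => ?_
      · simp [χ', AddMonoidAlgebra.single_mul_single]
      · simp [χ', hχ]
    · have h0 : ∀ r : R, c (AddMonoidAlgebra.single 0 r) = 0 := fun r => by
        change (AddMonoidAlgebra.single (0 : WithZero Ω) r).coeff (b : WithZero Ω) = 0
        simp
      intro w
      change (D ∘ₗ c) (wordEval χ' (List.finRange (u.length + 1)) w) = _
      rw [List.finRange_succ]
      cases w with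
      | nil =>
        rw [wordEval_nil, AddMonoidAlgebra.one_def, LinearMap.comp_apply, h0]
        simp
      | cons a w =>
        have h1 : c (χ' 0 a * AddMonoidAlgebra.single 0 (wordEval χ (List.finRange u.length) w)) =
            if a = b then wordEval χ (List.finRange u.length) w else 0 := by
          change (AddMonoidAlgebra.single (a : WithZero Ω) (1 : R) *
            AddMonoidAlgebra.single 0 _).coeff (b : WithZero Ω) = _
          simp [AddMonoidAlgebra.single_mul_single, Finsupp.single_apply]
        rw [wordEval_cons_cons, hsucc, hsucc, LinearMap.comp_apply, map_add, h0, zero_add, h1]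
        by_cases h : a = b <;> simp [h, hD]

theorem word_ext_of_wordEval [AddCommSemigroup Ω] {p q : List Ω →₀ k}
    (h : ∀ (R : Type (max v u)) [CommRing R] [Algebra k R] (n : ℕ) (χ : Fin n → Ω → R),
      (∀ x a b, χ x (a + b) = χ x a * χ x b) →
      wordEvalLin k χ (List.finRange n) p = wordEvalLin k χ (List.finRange n) q) : p = q := by
  classical
  ext u
  obtain ⟨R, _, _, χ, hχ, D, hD⟩ := exists_dual_wordEval k u
  have key : D ∘ₗ wordEvalLin k χ (List.finRange u.length) = Finsupp.lapply u :=
    word_hom_ext fun w => by simp [hD, Finsupp.single_apply]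
  have hp := LinearMap.congr_fun key p
  have hq := LinearMap.congr_fun key q
  simp only [LinearMap.comp_apply, Finsupp.lapply_apply] at hp hq
  rw [← hp, ← hq, h R _ χ hχ]

theorem word_tensor_ext_of_wordEval [AddCommSemigroup Ω] {p q : (List Ω →₀ k) ⊗[k] (List Ω →₀ k)}
    (h : ∀ (R : Type (max v u)) [CommRing R] [Algebra k R] (m n : ℕ) (χ : Fin m → Ω → R)
      (ψ : Fin n → Ω → R), (∀ x a b, χ x (a + b) = χ x a * χ x b) →
      (∀ x a b, ψ x (a + b) = ψ x a * ψ x b) →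
      wordEvalTensor k χ (List.finRange m) ψ (List.finRange n) p =
        wordEvalTensor k χ (List.finRange m) ψ (List.finRange n) q) : p = q := by
  classical
  refine (finsuppTensorFinsupp' k (List Ω) (List Ω)).injective (Finsupp.ext ?_)
  rintro ⟨u, u'⟩
  obtain ⟨R, _, _, χ, hχ, D, hD⟩ := exists_dual_wordEval k u
  obtain ⟨R', _, _, χ', hχ', D', hD'⟩ := exists_dual_wordEval k u'
  let i : R →ₐ[k] R ⊗[k] R' := Algebra.TensorProduct.includeLeft
  let i' : R' →ₐ[k] R ⊗[k] R' := Algebra.TensorProduct.includeRight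
  have hi : ∀ w, wordEval (fun x a => i (χ x a)) (List.finRange u.length) w =
      i (wordEval χ (List.finRange u.length) w) := fun w =>
    (map_wordEval i.toRingHom χ _ w).symm
  have hi' : ∀ w, wordEval (fun x a => i' (χ' x a)) (List.finRange u'.length) w =
      i' (wordEval χ' (List.finRange u'.length) w) := fun w =>
    (map_wordEval i'.toRingHom χ' _ w).symm
  have key : LinearMap.mul' k k ∘ₗ TensorProduct.map D D' ∘ₗ
      wordEvalTensor k (fun x a => i (χ x a)) (List.finRange u.length)
        (fun x a => i' (χ' x a)) (List.finRange u'.length) =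
      Finsupp.lapply (u, u') ∘ₗ (finsuppTensorFinsupp' k (List Ω) (List Ω)).toLinearMap := by
    refine TensorProduct.ext (word_hom_ext fun w => word_hom_ext fun w' => ?_)
    have hT : wordEvalTensor k (fun x a => i (χ x a)) (List.finRange u.length)
        (fun x a => i' (χ' x a)) (List.finRange u'.length)
        (Finsupp.single w 1 ⊗ₜ Finsupp.single w' 1) =
        wordEval χ (List.finRange u.length) w ⊗ₜ wordEval χ' (List.finRange u'.length) w' := by
      rw [wordEvalTensor_tmul, wordEvalLin_single, wordEvalLin_single, hi, hi']
      simp [i, i']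
    change LinearMap.mul' k k (TensorProduct.map D D' (wordEvalTensor k _ _ _ _
      (Finsupp.single w 1 ⊗ₜ Finsupp.single w' 1))) =
      finsuppTensorFinsupp' k (List Ω) (List Ω) (Finsupp.single w 1 ⊗ₜ Finsupp.single w' 1) (u, u')
    rw [hT, TensorProduct.map_tmul, hD, hD', finsuppTensorFinsupp'_single_tmul_single]
    by_cases h₁ : w = u <;> by_cases h₂ : w' = u' <;> simp [h₁, h₂]
  have hp := LinearMap.congr_fun key p
  have hq := LinearMap.congr_fun key q
  simp only [LinearMap.comp_apply, Finsupp.lapply_apply, LinearEquiv.coe_coe] at hp hq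
  rw [← hp, ← hq, h _ _ _ (fun x a => i (χ x a)) (fun x a => i' (χ' x a))
    (fun x a b => by rw [hχ, map_mul]) (fun x a b => by rw [hχ', map_mul])]

end Separation

section Arborification

variable {k : Type v} [Field k] {Ω : Type u}

theorem pairwise_lt_sumLex {X Y : Type*} [LT X] [LT Y] {l : List X} {m : List Y}
    (hl : l.Pairwise (· < ·)) (hm : m.Pairwise (· < ·)) :
    ((l.map Sum.inl ++ m.map Sum.inr).map (toLex : X ⊕ Y → X ⊕ₗ Y)).Pairwise (· < ·) := by
  rw [List.pairwise_map, List.pairwise_append, List.pairwise_map, List.pairwise_map]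
  refine ⟨hl.imp fun h => Sum.Lex.inl_lt_inl_iff.2 h, hm.imp fun h => Sum.Lex.inr_lt_inr_iff.2 h,
    ?_⟩
  intro a ha b hb
  obtain ⟨x, -, rfl⟩ := List.mem_map.1 ha
  obtain ⟨y, -, rfl⟩ := List.mem_map.1 hb
  exact Sum.Lex.inl_lt_inr x y

theorem pairwise_lt_prodLex {X Y : Type*} [LT X] [LT Y] {l : List X} {m : List Y}
    (hl : l.Pairwise (· < ·)) (hm : m.Pairwise (· < ·)) :
    ((l ×ˢ m).map (toLex : X × Y → X ×ₗ Y)).Pairwise (· < ·) := by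
  rw [List.pairwise_map]
  induction hl with
  | nil => simp
  | @cons x l hx _ ih =>
    rw [List.product_cons, List.pairwise_append, List.pairwise_map]
    refine ⟨hm.imp fun {y y'} h => Prod.Lex.lt_iff (x := toLex (x, y)) (y := toLex (x, y')).2
      (.inr ⟨rfl, h⟩), ih, ?_⟩
    intro a ha b hb
    obtain ⟨y, -, rfl⟩ := List.mem_map.1 ha
    exact Prod.Lex.lt_iff.2 (.inl (hx _ (List.mem_product.1 hb).1))

theorem wordEvalLin_map {R X Y : Type*} [CommRing R] [Algebra k R] (χ : Y → Ω → R) (f : X → Y)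
    (l : List X) (p : List Ω →₀ k) :
    wordEvalLin k χ (l.map f) p = wordEvalLin k (fun x => χ (f x)) l p := by
  suffices h : wordEvalLin k χ (l.map f) = wordEvalLin k (fun x => χ (f x)) l from
    LinearMap.congr_fun h p
  exact word_hom_ext fun w => by simp [wordEval_map]

theorem forestMul_single (F G : DecForest Ω) :
    forestMul k (Finsupp.single F.cls 1) (Finsupp.single G.cls 1) =
      Finsupp.single (F.union G).cls 1 := by
  rw [forestMul, Finsupp.linearCombination_single, one_smul, Finsupp.linearCombination_single,
    one_smul]
  rfl

variable [AddCommSemigroup Ω]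

theorem wordEvalLin_finRange_arborification {R : Type*} [CommRing R] [Algebra k R] {n : ℕ}
    (F : DecForest Ω) (χ : Fin n → Ω → R) (hχ : ∀ x a b, χ x (a + b) = χ x a * χ x b) :
    wordEvalLin k χ (List.finRange n) (arborification k (Finsupp.single F.cls 1)) = F.eval χ :=
  F.wordEvalLin_arborification χ hχ _ (List.pairwise_lt_finRange n) List.mem_finRange

theorem arborification_delta (p : ForestClass Ω →₀ k) :
    wordDelta k (arborification k p) =
      TensorProduct.map (arborification k) (arborification k) (forestDelta k p) := by
  suffices h : wordDelta k ∘ₗ arborification k (Ω := Ω) =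
      TensorProduct.map (arborification k) (arborification k) ∘ₗ forestDelta k from
    LinearMap.congr_fun h p
  refine forest_hom_ext fun F => word_tensor_ext_of_wordEval fun R _ _ m n χ ψ hχ hψ => ?_
  simp only [LinearMap.comp_apply, forestDelta_single, map_sum, TensorProduct.map_tmul,
    wordEvalTensor_tmul, wordEvalLin_finRange_arborification _ _ hχ,
    wordEvalLin_finRange_arborification _ _ hψ, wordEvalTensor_wordDelta]
  rw [← F.eval_sumLex χ ψ, ← F.wordEvalLin_arborification (k := k) _ _ _
    (pairwise_lt_sumLex (List.pairwise_lt_finRange m) (List.pairwise_lt_finRange n)),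
    wordEvalLin_map]
  · rfl
  · intro z
    rcases h : ofLex z with x | y
    · exact List.mem_map.2 ⟨Sum.inl x, by simp, h.symm⟩
    · exact List.mem_map.2 ⟨Sum.inr y, by simp, h.symm⟩
  · intro z a b
    rcases ofLex z with x | y
    · exact hχ x a b
    · exact hψ y a b

theorem arborification_gamma (p : ForestClass Ω →₀ k) :
    wordGamma k (arborification k p) =
      TensorProduct.map (arborification k) (arborification k) (forestGamma k p) := by
  suffices h : wordGamma k ∘ₗ arborification k (Ω := Ω) =
      TensorProduct.map (arborification k) (arborification k) ∘ₗ forestGamma k from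
    LinearMap.congr_fun h p
  refine forest_hom_ext fun F => word_tensor_ext_of_wordEval fun R _ _ m n χ ψ hχ hψ => ?_
  simp only [LinearMap.comp_apply, forestGamma_single, map_sum, TensorProduct.map_tmul,
    wordEvalTensor_tmul, wordEvalLin_finRange_arborification _ _ hχ,
    wordEvalLin_finRange_arborification _ _ hψ, wordEvalTensor_wordGamma χ ψ hχ hψ]
  rw [← F.eval_prodLex χ hχ ψ, ← F.wordEvalLin_arborification (k := k) _ _ _
    (pairwise_lt_prodLex (List.pairwise_lt_finRange m) (List.pairwise_lt_finRange n)),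
    wordEvalLin_map]
  · rfl
  · intro z
    exact List.mem_map.2 ⟨((ofLex z).1, (ofLex z).2),
      List.mem_product.2 ⟨List.mem_finRange _, List.mem_finRange _⟩, rfl⟩
  · intro z a b
    rw [hχ, hψ, mul_mul_mul_comm]

theorem arborification_mul (p q : ForestClass Ω →₀ k) :
    arborification k (forestMul k p q) =
      qshMul k (arborification k p) (arborification k q) := by
  suffices h : (forestMul k).compr₂ (arborification k (Ω := Ω)) =
      (qshMul k).compl₁₂ (arborification k) (arborification k) from
    LinearMap.congr_fun₂ h p q
  refine forest_hom_ext fun F => forest_hom_ext fun G =>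
    word_ext_of_wordEval fun R _ _ n χ hχ => ?_
  simp only [LinearMap.compr₂_apply, LinearMap.compl₁₂_apply, forestMul_single,
    wordEvalLin_qshMul χ hχ, wordEvalLin_finRange_arborification _ χ hχ, DecForest.eval_union]

end Arborification

namespace DecForest

variable {Ω : Type u}

theorem lt_wellFounded (F : DecForest Ω) : WellFounded F.lt :=
  have : IsTrans F.V F.lt := ⟨fun _ _ _ h h' => Relation.TransGen.trans h h'⟩
  haveI : Std.Irrefl F.lt := ⟨F.acyclic⟩
  Finite.wellFounded_of_trans_of_irrefl F.lt

theorem graft_lt_none_some (F : DecForest Ω) (b : Ω) (v : F.V) :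
    (F.graft b).lt (none : Option F.V) (some v : Option F.V) := by
  induction v using F.lt_wellFounded.induction with
  | h v ih =>
    by_cases h : F.IsRoot v
    · exact .single h
    · obtain ⟨u, hu⟩ := not_forall_not.1 h
      exact (ih u (.single hu)).tail hu

theorem linExt_graft_none (F : DecForest Ω) (b : Ω) {s : ℕ} (σ : (F.graft b).LinExt (s + 1)) :
    σ.1 (none : Option F.V) = Fin.last s := by
  obtain ⟨x, hx⟩ := σ.2.1 (Fin.last s)
  cases x with
  | none => exact hx
  | some v =>
    have h := σ.2.2 _ _ (F.graft_lt_none_some b v)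
    rw [hx] at h
    exact absurd h (not_lt.2 (Fin.le_last _))

theorem linExt_graft_some (F : DecForest Ω) (b : Ω) {s : ℕ} (σ : (F.graft b).LinExt (s + 1))
    (v : F.V) : σ.1 (some v : Option F.V) ≠ Fin.last s := by
  have h := σ.2.2 _ _ (F.graft_lt_none_some b v)
  rw [linExt_graft_none] at h
  exact h.ne

/-- In a linear extension of a grafted forest the root comes alone, in the last position. -/
def linExtGraftEquiv (F : DecForest Ω) (b : Ω) (s : ℕ) :
    F.LinExt s ≃ (F.graft b).LinExt (s + 1) where
  toFun τ := ⟨fun x : Option F.V => x.elim (Fin.last s) fun v => (τ.1 v).castSucc, by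
      intro i
      induction i using Fin.lastCases with
      | last => exact ⟨(none : Option F.V), rfl⟩
      | cast i =>
        obtain ⟨v, rfl⟩ := τ.2.1 i
        exact ⟨(some v : Option F.V), rfl⟩,
    ((F.graft b).isStrict_iff_lt _).1 fun x y hxy => by
      cases y with
      | none => cases x <;> exact hxy.elim
      | some v =>
        cases x with
        | none => exact Fin.castSucc_lt_last _
        | some u => exact τ.2.2 u v (.single hxy)⟩
  invFun σ := ⟨fun v => (σ.1 (some v : Option F.V)).castPred (F.linExt_graft_some b σ v), by
      intro i
      obtain ⟨x, hx⟩ := σ.2.1 i.castSucc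
      cases x with
      | none =>
        rw [linExt_graft_none] at hx
        exact absurd hx (Fin.castSucc_lt_last i).ne'
      | some v => exact ⟨v, by simp [hx]⟩,
    (F.isStrict_iff_lt _).1 fun u v huv =>
      σ.2.2 (some u : Option F.V) (some v : Option F.V) (.single huv)⟩
  left_inv τ := rfl
  right_inv σ := by
    refine Subtype.ext (funext fun x => ?_)
    cases x with
    | none => exact (F.linExt_graft_none b σ).symm
    | some v => rfl

theorem sum_graft {B : Type*} [AddCommMonoid B] (F : DecForest Ω) (b : Ω) (f : Option F.V → B) :
    ∑ x : (F.graft b).V, f x = f none + ∑ v : F.V, f (some v) := by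
  classical
  exact (sum_univ_congr fun _ => rfl).trans (Fintype.sum_option f)

theorem extWord_graft [AddCommSemigroup Ω] (F : DecForest Ω) (b : Ω) {s : ℕ} (τ : F.LinExt s) :
    (F.graft b).extWord (F.linExtGraftEquiv b s τ) = F.extWord τ ++ [b] := by
  classical
  rw [extWord, List.ofFn_succ', List.concat_eq_append]
  congr 1
  · refine congrArg List.ofFn (funext fun i => WithZero.coe_injective ?_)
    rw [coe_weightSum, coe_weightSum, Finset.sum_filter, Finset.sum_filter]
    refine (F.sum_graft b _).trans ((congrArg₂ (· + ·) (if_neg ?_) ?_).trans (zero_add _))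
    · exact (Fin.castSucc_lt_last i).ne'
    · exact Finset.sum_congr rfl fun v _ =>
        if_congr (Fin.castSucc_inj (a := τ.1 v) (b := i)) rfl rfl
  · refine congrArg (fun a => [a]) (WithZero.coe_injective ?_)
    rw [coe_weightSum, Finset.sum_filter]
    refine (F.sum_graft b _).trans ((congrArg₂ (· + ·) (if_pos ?_) ?_).trans (add_zero _))
    · rfl
    · exact Finset.sum_eq_zero fun v _ => if_neg (Fin.castSucc_lt_last (τ.1 v)).ne

/-- Every forest is obtained from the empty forest by disjoint unions and graftings. -/
theorem induction_union_graft {P : ForestClass Ω → Prop} (h_empty : P (empty Ω).cls)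
    (h_union : ∀ F G : DecForest Ω, P F.cls → P G.cls → P (F.union G).cls)
    (h_graft : ∀ (b : Ω) (F : DecForest Ω), P F.cls → P (F.graft b).cls) (F : DecForest Ω) :
    P F.cls := by
  classical
  induction hn : Nat.card F.V using Nat.strong_induction_on generalizing F with
  | _ n ih =>
    subst hn
    rcases isEmpty_or_nonempty F.V with hF | hF
    · rwa [show F.cls = (empty Ω).cls from
        cls_eq (G := empty Ω) (Equiv.equivOfIsEmpty F.V Empty) ⟨fun u => hF.elim u, fun u => hF.elim u⟩]
    · obtain ⟨ρ, -, hρ⟩ := F.lt_wellFounded.has_min Set.univ Set.univ_nonempty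
      have hroot : F.IsRoot ρ := fun u hu => hρ u trivial (.single hu)
      have ih' : ∀ (S : Set F.V) (x : F.V), x ∉ S → P (F.restrict S).cls := fun S x hx =>
        ih _ (Finite.card_subtype_lt hx) _ rfl
      let S : Set F.V := {v | v = ρ ∨ F.lt ρ v}
      have hS : ∀ u v, F.edge u v → (u ∈ S ↔ v ∈ S) := by
        intro u v huv
        constructor
        · rintro (rfl | h)
          · exact .inr (.single huv)
          · exact .inr (h.tail huv)
        · rintro (rfl | h)
          · exact (hroot u huv).elim
          · cases h with
            | single h => exact .inl (F.unique_parent _ _ _ huv h)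
            | tail h' h => exact .inr (F.unique_parent _ _ _ huv h ▸ h')
      by_cases hall : ∃ x, x ∉ S
      · obtain ⟨x, hx⟩ := hall
        have h := h_union _ _ (ih' S x hx) (ih' Sᶜ ρ (not_not.2 (.inl rfl)))
        rwa [show ((F.restrict S).union (F.restrict Sᶜ)).cls = F.cls from
          cls_eq (F := (F.restrict S).union (F.restrict Sᶜ)) (Equiv.Set.sumCompl S) ⟨?_, ?_⟩] at h
        · rintro (u | u) (v | v)
          · exact Sum.liftRel_inl_inl
          · exact iff_of_false Sum.not_liftRel_inl_inr fun huv => v.2 ((hS u.1 v.1 huv).1 u.2)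
          · exact iff_of_false Sum.not_liftRel_inr_inl fun huv => u.2 ((hS u.1 v.1 huv).2 v.2)
          · exact Sum.liftRel_inr_inr
        · rintro (v | v) <;> rfl
      · have hall : ∀ x, x ∈ S := fun x => by_contra fun hx => hall ⟨x, hx⟩
        have h := h_graft (F.dec ρ) _ (ih' {v | v ≠ ρ} ρ fun h => h rfl)
        rwa [show ((F.restrict {v | v ≠ ρ}).graft (F.dec ρ)).cls = F.cls from
          cls_eq (F := (F.restrict {v | v ≠ ρ}).graft (F.dec ρ)) (Equiv.optionSubtypeNe ρ)
            ⟨?_, ?_⟩] at h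
        · intro u v
          cases v with
          | none =>
            refine iff_of_false (fun h => by cases u <;> exact h) ?_
            exact hroot _
          | some v =>
            cases u with
            | some u => exact Iff.rfl
            | none =>
              change (F.restrict {v | v ≠ ρ}).IsRoot v ↔ F.edge ρ v.1
              constructor
              · intro hv
                have : ∃ u, F.edge u v.1 := by
                  cases (hall v.1).resolve_left v.2 with
                  | single h => exact ⟨_, h⟩
                  | tail _ h => exact ⟨_, h⟩
                obtain ⟨u, hu⟩ := this
                by_cases huρ : u = ρ
                · exact huρ ▸ hu
                · exact (hv ⟨u, huρ⟩ hu).elim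
              · intro hv u hu
                exact u.2 (F.unique_parent _ _ _ hu hv)
        · rintro (_ | v) <;> rfl

end DecForest

section Final

variable {k : Type v} [Field k] {Ω : Type u}

theorem forestGraft_single (b : Ω) (F : DecForest Ω) :
    forestGraft k b (Finsupp.single F.cls 1) = Finsupp.single (F.graft b).cls 1 := by
  rw [forestGraft, Finsupp.lmapDomain_apply, Finsupp.mapDomain_single]
  rfl

variable [AddCommSemigroup Ω]

theorem arborification_empty :
    arborification k (Finsupp.single (DecForest.empty Ω).cls 1) = Finsupp.single [] 1 := by
  classical
  refine word_ext_of_wordEval fun R _ _ n χ hχ => ?_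
  rw [wordEvalLin_finRange_arborification _ χ hχ, wordEvalLin_single, wordEval_nil, one_smul,
    DecForest.eval]
  have : IsEmpty (DecForest.empty Ω).V := inferInstanceAs (IsEmpty Empty)
  rw [Finset.filter_true_of_mem fun σ _ u => isEmptyElim u]
  simp

theorem arborification_graft (b : Ω) (p : ForestClass Ω →₀ k) :
    arborification k (forestGraft k b p) = wordAppend k b (arborification k p) := by
  suffices h : arborification k ∘ₗ forestGraft k b =
      wordAppend k b ∘ₗ arborification k (Ω := Ω) from LinearMap.congr_fun h p
  refine forest_hom_ext fun F => ?_
  have hcard : Nat.card (F.graft b).V = Nat.card F.V + 1 := Finite.card_option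
  have : IsEmpty ((F.graft b).LinExt 0) := ⟨fun σ => (σ.1 (none : Option F.V)).elim0⟩
  rw [LinearMap.comp_apply, LinearMap.comp_apply, forestGraft_single, arborification_single,
    arborification_single, hcard, Finset.sum_range_succ', Fintype.sum_empty, add_zero]
  simp only [map_sum]
  refine Finset.sum_congr rfl fun s _ => ?_
  refine (Fintype.sum_equiv (F.linExtGraftEquiv b s) _ _ fun τ => ?_).symm
  rw [F.extWord_graft, wordAppend, Finsupp.lmapDomain_apply, Finsupp.mapDomain_single]

theorem isContractingArborification_arborification :
    IsContractingArborification k (arborification k (Ω := Ω)) where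
  map_one := arborification_empty
  map_mul := arborification_mul
  map_graft := arborification_graft

theorem IsContractingArborification.unique {a a' : (ForestClass Ω →₀ k) →ₗ[k] (List Ω →₀ k)}
    (h : IsContractingArborification k a) (h' : IsContractingArborification k a') : a = a' := by
  refine forest_hom_ext (DecForest.induction_union_graft
    (P := fun x => a (Finsupp.single x 1) = a' (Finsupp.single x 1)) ?_ ?_ ?_)
  · rw [h.map_one, h'.map_one]
  · intro F G hF hG
    rw [← forestMul_single, h.map_mul, h'.map_mul, hF, hG]
  · intro b F hF
    rw [← forestGraft_single, h.map_graft, h'.map_graft, hF]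

theorem dualProduct_comp {A H H' : Type*} [CommRing A] [Algebra k A] [AddCommGroup H] [Module k H]
    [AddCommGroup H'] [Module k H'] (δ : H →ₗ[k] H ⊗[k] H) (δ' : H' →ₗ[k] H' ⊗[k] H')
    (f : H' →ₗ[k] H) (hf : ∀ x, δ (f x) = TensorProduct.map f f (δ' x)) (M N : H →ₗ[k] A) :
    dualProduct δ M N ∘ₗ f = dualProduct δ' (M ∘ₗ f) (N ∘ₗ f) := by
  ext x
  simp only [dualProduct, LinearMap.comp_apply, hf, TensorProduct.map_comp]

end Final

theorem theorem5p5 {k : Type*} [Field k] {A : Type*} [CommRing A] [Algebra k A]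
    {Ω : Type*} [AddCommSemigroup Ω] :
    (∀ M N P : ArbMould k A Ω,
      ArbMould.prod (ArbMould.prod M N) P = ArbMould.prod M (ArbMould.prod N P)) ∧
    (∀ M N P : ArbMould k A Ω,
      ArbMould.diamond (ArbMould.diamond M N) P = ArbMould.diamond M (ArbMould.diamond N P)) ∧
    (IsContractingArborification k (arborification k (Ω := Ω)) ∧
      ∀ a : (ForestClass Ω →₀ k) →ₗ[k] (List Ω →₀ k),
        IsContractingArborification k a → a = arborification k) ∧
    (∀ M N : Mould k A Ω,
      Mould.arborify (Mould.prod M N) =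
        ArbMould.prod (Mould.arborify M) (Mould.arborify N)) ∧
    (∀ M N : Mould k A Ω,
      Mould.arborify (Mould.diamond M N) =
        ArbMould.diamond (Mould.arborify M) (Mould.arborify N)) :=
  ⟨ArbMould.prod_assoc, ArbMould.diamond_assoc,
    ⟨isContractingArborification_arborification,
      fun _ ha => ha.unique isContractingArborification_arborification⟩,
    dualProduct_comp _ _ _ arborification_delta, dualProduct_comp _ _ _ arborification_gamma⟩
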